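/- Let $(X,\mathcal B,m)$ be a probability space and let $\tau:X\to X$ be an invertible, bimeasurable, measure preserving transformation. For a probability measure $\mu$ on $\mathbb Z$ write $E(\mu)=\sum_{k\in\mathbb Z}k\,\mu(k)$ and $m_p(\mu)=\sum_{k\in\mathbb Z}|k|^p\mu(k)$. Let $(\nu_n)_{n\ge 1}$ be a sequence of probability measures on $\mathbb Z$ for which there are constants $a\ge 0$ and $\rho<1$ such that 1. $E(\nu_n)=0$ for all $n$; 2. $m_1(\nu_n)\le a$ for all $n$; 3. $\nu_n(\beta\mathbb Z+\alpha)\le\rho$ for all $n$, all integers $\beta\ge 2$ and all $\alpha\in\mathbb Z$; 4. $\sum_{i=1}^{n}m_2(\nu_i)=O(n)$ as $n\to\infty$ (in particular every $m_2(\nu_i)$ is finite). Let $\mu_n=\nu_1*\cdots*\nu_n$. Then for every (real- or complex-valued) $f\in L^1(X)$, for $m$-almost every $x\in X$, the series $\mu_nf(x)=\sum_{k\in\mathbb Z}\mu_n(k)f(\tau^kx)$ converges absolutely for every $n$, and the sequence $(\mu_nf(x))_{n\ge 1}$ converges to a finite limit. -/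

import Mathlib

open MeasureTheory Filter Topology
open scoped ENNReal NNReal

noncomputable section

/-- The convolution product `ν₀ ∗ ⋯ ∗ ν_{n-1}` of the first `n` members of a sequence of
measures on `ℤ` (the empty product being the Dirac mass at `0`). -/
def convProd (ν : ℕ → Measure ℤ) : ℕ → Measure ℤ
  | 0 => Measure.dirac 0
  | n + 1 => Measure.conv (convProd ν n) (ν n)

/-- The absolute moment `m_p(μ) = ∑ₖ |k|^p μ(k)`, with values in `[0, ∞]`. -/
def absMoment (p : ℝ) (μ : Measure ℤ) : ℝ≥0∞ :=
  ∑' k : ℤ, ENNReal.ofReal (|(k : ℝ)| ^ p) * μ {k}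

/-- The expectation `E(μ) = ∑ₖ k μ(k)`, meaningful when the first absolute moment of `μ`
is finite. -/
def expectation (μ : Measure ℤ) : ℝ :=
  ∑' k : ℤ, (k : ℝ) * μ.real {k}

/-- The terms `μ(k) f(τᵏ x)`, `k ∈ ℤ`, of the weighted average of `f` at `x`. -/
def averageTerm {X 𝕜 : Type*} [MeasurableSpace X] [RCLike 𝕜] (τ : X ≃ᵐ X) (μ : Measure ℤ)
    (f : X → 𝕜) (x : X) (k : ℤ) : 𝕜 :=
  (μ.real {k} : 𝕜) * f ((τ.toEquiv ^ k : Equiv.Perm X) x)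

/-- The weighted average `μ f(x) = ∑ₖ μ(k) f(τᵏ x)`. -/
def weightedAverage {X 𝕜 : Type*} [MeasurableSpace X] [RCLike 𝕜] (τ : X ≃ᵐ X)
    (μ : Measure ℤ) (f : X → 𝕜) (x : X) : 𝕜 :=
  ∑' k : ℤ, averageTerm τ μ f x k

end

/-!
Write `A(t) = E[e^{itS}]` and `D(t) = E[S² e^{itS}]` for a random variable `S` with law `μ_n`.

A compactness argument (`exists_norm_fourierMoment_zero_le`) turns the bound on first moments and
the coset condition into `|ν̂_n(t)| ≤ e^{-ct²}` on `[-π, π]` with a common `c > 0`. As the `ν_n` are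
centred with second moments summing to `O(n)`, the product rule gives `|A(t)| ≤ e^{-cnt²}` and
`|D(t)| = O(n e^{-cnt²/2})`, and Fourier inversion yields (`exists_diffusiveBounds_convProd`)
`μ_n(k) = O(n^{-1/2})`, `k² μ_n(k) = O(n^{1/2})` and `μ_n(k) - μ_n(k + 1) = O(n⁻¹)`.

The first two bounds dominate `μ_n` by a multiple of a Poisson kernel at height `√n`, hence by a
combination of uniform measures on symmetric intervals with bounded total weight
(`sum_mul_le_of_symmetric_means_le`). So `sup_n |μ_n f|` is controlled by the ergodic maximal
functions of `τ` and `τ⁻¹`, and is of weak type `(1,1)` by the maximal ergodic theorem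
(`measure_exists_lt_norm_weightedAverage_le`).

Together the bounds give `∑_k |μ_n(k) - μ_n(k + 1)| → 0`, so `μ_n` annihilates bounded coboundaries
`g - g ∘ τ` in the limit, while it fixes invariant functions. By von Neumann's mean ergodic theorem
sums of these two kinds are dense in `L¹`, and the weak type inequality extends the almost
everywhere convergence to all of `L¹`.
-/

/-! ### Trigonometric moments of measures on `ℤ` -/

/-- The trigonometric moment `E[Sᵖ e^{itS}]` of a measure on `ℤ`; up to a power of `i` it is the
`p`-th derivative of the characteristic function. -/
noncomputable def fourierMoment (p : ℕ) (μ : Measure ℤ) (t : ℝ) : ℂ :=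
  ∫ k, (k : ℂ) ^ p * Complex.exp ((k : ℝ) * t * Complex.I) ∂μ

theorem norm_exp_int_mul_I (k : ℤ) (t : ℝ) :
    ‖Complex.exp ((k : ℝ) * t * Complex.I)‖ = 1 := by
  rw [← Complex.ofReal_mul, Complex.norm_exp_ofReal_mul_I]

theorem exp_int_mul_I_add (j k : ℤ) (t : ℝ) :
    Complex.exp (((j + k : ℤ) : ℝ) * t * Complex.I) =
      Complex.exp ((j : ℝ) * t * Complex.I) * Complex.exp ((k : ℝ) * t * Complex.I) := by
  rw [← Complex.exp_add]
  push_cast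
  ring_nf

theorem integrable_fourierMoment {μ : Measure ℤ} [IsFiniteMeasure μ]
    (h : Integrable (fun k : ℤ => (k : ℝ) ^ 2) μ) {p : ℕ} (hp : p ≤ 2) (t : ℝ) :
    Integrable (fun k : ℤ => (k : ℂ) ^ p * Complex.exp ((k : ℝ) * t * Complex.I)) μ := by
  refine ((integrable_const (1 : ℝ)).add h).mono' (by fun_prop) (ae_of_all _ fun k => ?_)
  simp only [norm_mul, norm_pow, norm_exp_int_mul_I, mul_one, Pi.add_apply, Complex.norm_intCast]
  have h0 := abs_nonneg (k : ℝ)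
  interval_cases p
  · simp; positivity
  · nlinarith [sq_nonneg (|(k : ℝ)| - 1), sq_abs (k : ℝ)]
  · simp

theorem integrable_sq_conv {μ ν : Measure ℤ} [IsFiniteMeasure μ] [IsFiniteMeasure ν]
    (hμ : Integrable (fun k : ℤ => (k : ℝ) ^ 2) μ) (hν : Integrable (fun k : ℤ => (k : ℝ) ^ 2) ν) :
    Integrable (fun k : ℤ => (k : ℝ) ^ 2) (μ.conv ν) := by
  rw [Measure.conv, integrable_map_measure (by fun_prop) (by fun_prop)]
  have h1 : Integrable (fun z : ℤ × ℤ => (z.1 : ℝ) ^ 2) (μ.prod ν) := hμ.comp_fst ν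
  have h2 : Integrable (fun z : ℤ × ℤ => (z.2 : ℝ) ^ 2) (μ.prod ν) := hν.comp_snd μ
  refine ((h1.add h2).const_mul 2).mono' (by fun_prop) (ae_of_all _ fun z => ?_)
  simp only [Function.comp, Int.cast_add, norm_pow, Real.norm_eq_abs, sq_abs, Pi.add_apply]
  nlinarith [sq_nonneg ((z.1 : ℝ) - z.2)]

theorem fourierMoment_conv_eq {μ ν : Measure ℤ} [IsFiniteMeasure μ] [IsFiniteMeasure ν]
    (p : ℕ) (t : ℝ) :
    fourierMoment p (μ.conv ν) t = ∫ z : ℤ × ℤ, ((z.1 : ℂ) + z.2) ^ p *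
      (Complex.exp ((z.1 : ℝ) * t * Complex.I) * Complex.exp ((z.2 : ℝ) * t * Complex.I))
        ∂(μ.prod ν) := by
  rw [fourierMoment, Measure.conv, integral_map (by fun_prop) (by fun_prop)]
  refine integral_congr_ae (ae_of_all _ fun z => ?_)
  simp only [exp_int_mul_I_add]
  push_cast
  rfl

theorem fourierMoment_zero_conv {μ ν : Measure ℤ} [IsFiniteMeasure μ] [IsFiniteMeasure ν] (t : ℝ) :
    fourierMoment 0 (μ.conv ν) t = fourierMoment 0 μ t * fourierMoment 0 ν t := by
  rw [fourierMoment_conv_eq, fourierMoment, fourierMoment, ← integral_prod_mul]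
  refine integral_congr_ae (ae_of_all _ fun z => ?_)
  simp

theorem fourierMoment_one_conv {μ ν : Measure ℤ} [IsFiniteMeasure μ] [IsFiniteMeasure ν]
    (hμ : Integrable (fun k : ℤ => (k : ℝ) ^ 2) μ) (hν : Integrable (fun k : ℤ => (k : ℝ) ^ 2) ν)
    (t : ℝ) :
    fourierMoment 1 (μ.conv ν) t =
      fourierMoment 1 μ t * fourierMoment 0 ν t + fourierMoment 0 μ t * fourierMoment 1 ν t := by
  have I := fun {p q : ℕ} (hp : p ≤ 2) (hq : q ≤ 2) =>
    (integrable_fourierMoment hμ hp t).mul_prod (integrable_fourierMoment hν hq t)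
  rw [fourierMoment_conv_eq]
  simp only [fourierMoment, ← integral_prod_mul]
  rw [← integral_add (I (by norm_num) (by norm_num)) (I (by norm_num) (by norm_num))]
  refine integral_congr_ae (ae_of_all _ fun z => ?_)
  simp only
  ring

theorem fourierMoment_two_conv {μ ν : Measure ℤ} [IsFiniteMeasure μ] [IsFiniteMeasure ν]
    (hμ : Integrable (fun k : ℤ => (k : ℝ) ^ 2) μ) (hν : Integrable (fun k : ℤ => (k : ℝ) ^ 2) ν)
    (t : ℝ) :
    fourierMoment 2 (μ.conv ν) t =
      fourierMoment 2 μ t * fourierMoment 0 ν t + 2 * (fourierMoment 1 μ t * fourierMoment 1 ν t)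
        + fourierMoment 0 μ t * fourierMoment 2 ν t := by
  have I := fun {p q : ℕ} (hp : p ≤ 2) (hq : q ≤ 2) =>
    (integrable_fourierMoment hμ hp t).mul_prod (integrable_fourierMoment hν hq t)
  rw [fourierMoment_conv_eq]
  simp only [fourierMoment, ← integral_prod_mul]
  have I20 := I (p := 2) (q := 0) (by norm_num) (by norm_num)
  have I11 := I (p := 1) (q := 1) (by norm_num) (by norm_num)
  have I02 := I (p := 0) (q := 2) (by norm_num) (by norm_num)
  rw [← integral_const_mul, ← integral_add I20 (I11.const_mul 2)]
  refine Eq.trans ?_ (integral_add (I20.add (I11.const_mul 2)) I02)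
  refine integral_congr_ae (ae_of_all _ fun z => ?_)
  simp only
  ring

theorem norm_fourierMoment_two_le (μ : Measure ℤ) (t : ℝ) :
    ‖fourierMoment 2 μ t‖ ≤ ∫ k : ℤ, (k : ℝ) ^ 2 ∂μ := by
  refine (norm_integral_le_integral_norm _).trans_eq ?_
  refine integral_congr_ae (ae_of_all _ fun k => ?_)
  simp [norm_exp_int_mul_I, -Complex.ofReal_intCast]

/-- The first trigonometric moment of a centred measure is `E[S (e^{itS} - 1)]`, hence it is of
order `t`. -/
theorem norm_fourierMoment_one_le {μ : Measure ℤ} [IsFiniteMeasure μ]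
    (hμ : Integrable (fun k : ℤ => (k : ℝ) ^ 2) μ) (h0 : ∫ k : ℤ, (k : ℝ) ∂μ = 0) (t : ℝ) :
    ‖fourierMoment 1 μ t‖ ≤ |t| * ∫ k : ℤ, (k : ℝ) ^ 2 ∂μ := by
  have hint : Integrable (fun k : ℤ => (k : ℂ)) μ := by
    simpa using integrable_fourierMoment hμ (p := 1) (by norm_num) 0
  have hz : ∫ k : ℤ, (k : ℂ) ∂μ = 0 := by
    have : ∫ k : ℤ, ((k : ℝ) : ℂ) ∂μ = 0 := by rw [integral_complex_ofReal, h0]; simp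
    simpa using this
  have : fourierMoment 1 μ t =
      ∫ k : ℤ, (k : ℂ) ^ 1 * Complex.exp ((k : ℝ) * t * Complex.I) - (k : ℂ) ∂μ := by
    rw
      [integral_sub (integrable_fourierMoment hμ (by norm_num) t) hint, hz, sub_zero, fourierMoment]
  rw [this, ← integral_const_mul]
  refine norm_integral_le_of_norm_le (hμ.const_mul _) (ae_of_all _ fun k => ?_)
  have e : (k : ℂ) ^ 1 * Complex.exp ((k : ℝ) * t * Complex.I) - (k : ℂ) =
      (k : ℂ) * (Complex.exp (Complex.I * ((k * t : ℝ) : ℂ)) - 1) := by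
    push_cast
    ring_nf
  rw [e, norm_mul, Complex.norm_intCast]
  calc |(k : ℝ)| * _ ≤ |(k : ℝ)| * ‖(k * t : ℝ)‖ := by
        gcongr
        exact Real.norm_exp_I_mul_ofReal_sub_one_le
    _ = |t| * (k : ℝ) ^ 2 := by rw [Real.norm_eq_abs, abs_mul, ← sq_abs (k : ℝ)]; ring

theorem integral_exp_int_mul_I (d : ℤ) :
    ∫ t in (-Real.pi)..Real.pi, Complex.exp ((d : ℝ) * t * Complex.I) =
      if d = 0 then 2 * Real.pi else 0 := by
  split_ifs with h
  · subst h; simp; ring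
  · have hc : ((d : ℂ) * Complex.I) ≠ 0 := by simp [h]
    have : ∀ t : ℝ, Complex.exp ((d : ℝ) * t * Complex.I) =
        Complex.exp ((d : ℂ) * Complex.I * t) := fun t => by push_cast; ring_nf
    simp_rw [this]
    rw [integral_exp_mul_complex hc]
    have : Complex.exp ((d : ℂ) * Complex.I * (Real.pi : ℝ)) =
        Complex.exp ((d : ℂ) * Complex.I * (-Real.pi : ℝ)) := by
      rw [Complex.exp_eq_exp_iff_exists_int]
      exact ⟨d, by push_cast; ring⟩
    rw [this]; simp

/-- Fourier inversion on `ℤ`. -/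
theorem integral_fourierMoment_mul_exp {μ : Measure ℤ} [IsFiniteMeasure μ]
    (h : Integrable (fun k : ℤ => (k : ℝ) ^ 2) μ) {p : ℕ} (hp : p ≤ 2) (k : ℤ) :
    ∫ t in (-Real.pi)..Real.pi, fourierMoment p μ t * Complex.exp (((-k : ℤ) : ℝ) * t * Complex.I) =
      2 * Real.pi * ((k : ℂ) ^ p * μ.real {k}) := by
  simp only [fourierMoment, ← integral_mul_const]
  rw [intervalIntegral_integral_swap]
  · have : ∀ j : ℤ, ∫ t in (-Real.pi)..Real.pi, (j : ℂ) ^ p *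
        Complex.exp ((j : ℝ) * t * Complex.I) * Complex.exp (((-k : ℤ) : ℝ) * t * Complex.I) =
        Set.indicator {k} (fun j : ℤ => (j : ℂ) ^ p * (2 * Real.pi)) j := by
      intro j
      simp_rw [mul_assoc ((j : ℂ) ^ p), ← exp_int_mul_I_add]
      rw [intervalIntegral.integral_const_mul, integral_exp_int_mul_I]
      by_cases hjk : j = k
      · simp [hjk]
      · rw [if_neg (by omega)]; simp [hjk]
    simp_rw [this]
    rw [integral_indicator (measurableSet_singleton k), integral_singleton]
    simp; ring
  · rw [Set.uIoc_of_le (by linarith [Real.pi_pos])]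
    have hg : Integrable (fun z : ℝ × ℤ => 1 + (z.2 : ℝ) ^ 2)
        ((volume.restrict (Set.Ioc (-Real.pi) Real.pi)).prod μ) :=
      ((integrable_const (1 : ℝ)).add h).comp_snd _
    refine hg.mono' (by fun_prop) (ae_of_all _ fun z => ?_)
    simp only [Function.uncurry, norm_mul, norm_pow, norm_exp_int_mul_I, mul_one,
      Complex.norm_intCast]
    have h0 := abs_nonneg (z.2 : ℝ)
    interval_cases p
    · simp; positivity
    · nlinarith [sq_nonneg (|(z.2 : ℝ)| - 1), sq_abs (z.2 : ℝ)]
    · simp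

theorem continuous_fourierMoment {μ : Measure ℤ} [IsFiniteMeasure μ] :
    Continuous (fourierMoment 0 μ) := by
  refine continuous_of_dominated (bound := fun _ => 1) (fun t => by fun_prop)
    (fun t => ae_of_all _ fun k => ?_) (integrable_const _) (ae_of_all _ fun k => by fun_prop)
  simp [norm_exp_int_mul_I, -Complex.ofReal_intCast]

/-! ### Uniform aperiodicity -/

/-- `(1 - cos (d t)) / t²`, written through the cardinal sine so as to be continuous at `t = 0`. -/
noncomputable def cosDefect (d : ℤ) (t : ℝ) : ℝ := (d : ℝ) ^ 2 / 2 * Real.sinc (d * t / 2) ^ 2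

theorem cosDefect_nonneg (d : ℤ) (t : ℝ) : 0 ≤ cosDefect d t := by
  unfold cosDefect; positivity

theorem sq_mul_cosDefect (d : ℤ) (t : ℝ) : t ^ 2 * cosDefect d t = 1 - Real.cos (d * t) := by
  unfold cosDefect
  have h2 : Real.cos (d * t) = 1 - 2 * Real.sin (d * t / 2) ^ 2 := by
    have := Real.cos_two_mul (d * t / 2)
    rw [show 2 * ((d : ℝ) * t / 2) = d * t by ring] at this
    rw [this, Real.cos_sq']; ring
  rw [h2]
  by_cases h : (d : ℝ) * t / 2 = 0
  · have h' : (d : ℝ) * t = 0 := by linarith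
    rw [h]
    have : t ^ 2 * ((d : ℝ) ^ 2 / 2 * Real.sinc 0 ^ 2) = (d * t) ^ 2 / 2 * Real.sinc 0 ^ 2 := by
      ring
    rw [this, h']; simp
  · rw [Real.sinc_of_ne_zero h]
    have hd : (d : ℝ) ≠ 0 := fun h' => h (by simp [h'])
    have ht : t ≠ 0 := fun h' => h (by simp [h'])
    field_simp
    ring

/-- For `0 < |t| ≤ π` the integers `d` with `d t ∈ 2πℤ` form a subgroup of `ℤ` omitting `1`, while
for `t = 0` the defect vanishes only at `d = 0`; a trivial subgroup lies in `βℤ` for every `β`. -/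
theorem exists_two_le_dvd_of_cosDefect_eq_zero {t : ℝ} (ht : |t| ≤ Real.pi) :
    ∃ β : ℤ, 2 ≤ β ∧ ∀ d : ℤ, cosDefect d t = 0 → β ∣ d := by
  by_cases ht0 : t = 0
  · refine ⟨2, le_rfl, fun d hd => ?_⟩
    have : (d : ℝ) = 0 := by simpa [cosDefect, ht0] using hd
    rw [Int.cast_eq_zero.1 this]; exact dvd_zero _
  have key : ∀ d : ℤ, cosDefect d t = 0 → Real.cos (d * t) = 1 := fun d hd => by
    have := sq_mul_cosDefect d t
    rw [hd] at this; linarith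
  let H : AddSubgroup ℤ :=
    { carrier := {d | ∃ n : ℤ, (n : ℝ) * (2 * Real.pi) = d * t}
      zero_mem' := ⟨0, by simp⟩
      add_mem' := by
        rintro a b ⟨n, hn⟩ ⟨k, hk⟩
        exact ⟨n + k, by push_cast; linarith⟩
      neg_mem' := by
        rintro a ⟨n, hn⟩
        exact ⟨-n, by push_cast; linarith⟩ }
  obtain ⟨b, hb⟩ := Int.subgroup_cyclic H
  have hmem : ∀ d : ℤ, cosDefect d t = 0 → b ∣ d := fun d hd => by
    obtain ⟨n, hn⟩ := (Real.cos_eq_one_iff _).1 (key d hd)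
    have : d ∈ H := ⟨n, hn⟩
    rw [hb, AddSubgroup.mem_closure_singleton] at this
    obtain ⟨k, hk⟩ := this
    exact ⟨k, by rw [← hk, smul_eq_mul, mul_comm]⟩
  have h1 : (1 : ℤ) ∉ H := by
    rintro ⟨n, hn⟩
    have hn0 : n ≠ 0 := by
      rintro rfl
      exact ht0 (by simpa using hn.symm)
    have : (1 : ℝ) ≤ |(n : ℝ)| := by exact_mod_cast Int.one_le_abs hn0
    have h3 : |(n : ℝ)| * (2 * Real.pi) = |t| := by
      rw [← abs_of_pos (show (0 : ℝ) < 2 * Real.pi by positivity), ← abs_mul, hn]; simp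
    nlinarith [Real.pi_pos]
  have hb1 : |b| ≠ 1 := fun h => h1 <| by
    rw [hb, AddSubgroup.mem_closure_singleton]
    rcases (abs_eq zero_le_one).1 h with h | h
    · exact ⟨1, by simp [h]⟩
    · exact ⟨-1, by simp [h]⟩
  by_cases hb0 : b = 0
  · refine ⟨2, le_rfl, fun d hd => ?_⟩
    have := hmem d hd
    rw [hb0, zero_dvd_iff] at this
    rw [this]; exact dvd_zero _
  · refine ⟨|b|, ?_, fun d hd => (abs_dvd _ _).2 (hmem d hd)⟩
    have := abs_pos.2 hb0
    omega

/-- The weight vectors on a finite set `s` of total mass at least `q` which give mass at most `ρ`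
to each coset of a proper subgroup of `ℤ`. -/
def spreadWeights (s : Finset ℤ) (q ρ : ℝ) : Set (ℤ → ℝ) :=
  Set.pi Set.univ (fun _ => Set.Icc 0 1) ∩ {p | q ≤ ∑ j ∈ s, p j} ∩
    ⋂ (β : ℤ) (α : ℤ) (_ : 2 ≤ β), {p | ∑ j ∈ s with β ∣ j - α, p j ≤ ρ}

theorem isCompact_spreadWeights (s : Finset ℤ) (q ρ : ℝ) : IsCompact (spreadWeights s q ρ) := by
  refine ((isCompact_univ_pi fun _ => isCompact_Icc).inter_right ?_).inter_right ?_
  · exact isClosed_le continuous_const (by fun_prop)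
  · refine isClosed_iInter fun β => isClosed_iInter fun α => isClosed_iInter fun _ => ?_
    exact isClosed_le (by fun_prop) continuous_const

/-- Uniform aperiodicity of spread weights, by compactness. -/
theorem exists_pos_le_sum_cosDefect (s : Finset ℤ) {q ρ : ℝ} (hq : 0 < q) (hρ : ρ < q) :
    ∃ c : ℝ, 0 < c ∧ ∀ p ∈ spreadWeights s q ρ, ∀ t : ℝ, |t| ≤ Real.pi →
      c ≤ ∑ j ∈ s, ∑ k ∈ s, p j * p k * cosDefect (j - k) t := by
  have hK : IsCompact (Set.Icc (-Real.pi) Real.pi ×ˢ spreadWeights s q ρ) :=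
    isCompact_Icc.prod (isCompact_spreadWeights s q ρ)
  have hc : Continuous fun z : ℝ × (ℤ → ℝ) =>
      ∑ j ∈ s, ∑ k ∈ s, z.2 j * z.2 k * cosDefect (j - k) z.1 := by
    unfold cosDefect
    have := Real.continuous_sinc
    fun_prop
  obtain ⟨c, hc0, hc⟩ := hK.exists_forall_le' hc.continuousOn (a := 0) (by
    rintro ⟨t, p⟩ ⟨ht, ⟨hp1, hp2⟩, hp3⟩
    simp only [Set.mem_pi, Set.mem_univ, true_imp_iff, Set.mem_Icc] at hp1
    simp only [Set.mem_iInter, Set.mem_ofPred_eq] at hp2 hp3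
    have hnn : ∀ j k, 0 ≤ p j * p k * cosDefect (j - k) t := fun j k =>
      mul_nonneg (mul_nonneg (hp1 j).1 (hp1 k).1) (cosDefect_nonneg _ _)
    by_contra! hle
    have h0 : ∑ j ∈ s, ∑ k ∈ s, p j * p k * cosDefect (j - k) t = 0 :=
      le_antisymm hle (Finset.sum_nonneg fun j _ => Finset.sum_nonneg fun k _ => hnn j k)
    have hz : ∀ j ∈ s, ∀ k ∈ s, p j * p k * cosDefect (j - k) t = 0 := fun j hj =>
      (Finset.sum_eq_zero_iff_of_nonneg fun k _ => hnn j k).1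
        ((Finset.sum_eq_zero_iff_of_nonneg
          fun j _ => Finset.sum_nonneg fun k _ => hnn j k).1 h0 j hj)
    obtain ⟨β, hβ, hdvd⟩ := exists_two_le_dvd_of_cosDefect_eq_zero (abs_le.2 ht)
    obtain ⟨i, hi, hpi⟩ : ∃ i ∈ s, p i ≠ 0 := by
      by_contra! h
      rw [Finset.sum_eq_zero h] at hp2
      linarith
    have : ∑ j ∈ s with β ∣ j - i, p j = ∑ j ∈ s, p j := by
      rw [Finset.sum_filter]
      refine Finset.sum_congr rfl fun j hj => ?_
      split_ifs with h
      · rfl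
      · by_contra hpj
        refine h (hdvd _ ?_)
        simpa [hpi, Ne.symm hpj] using hz j hj i hi
    have := hp3 β i hβ
    linarith)
  exact ⟨c, hc0, fun p hp t ht => hc (t, p) ⟨abs_le.1 ht, hp⟩⟩

theorem sq_norm_sum_mul_exp (s : Finset ℤ) (p : ℤ → ℝ) (t : ℝ) :
    ‖∑ j ∈ s, p j • Complex.exp ((j : ℝ) * t * Complex.I)‖ ^ 2 =
      (∑ j ∈ s, p j) ^ 2 - t ^ 2 * ∑ j ∈ s, ∑ k ∈ s, p j * p k * cosDefect (j - k) t := by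
  have hre : (∑ j ∈ s, p j • Complex.exp ((j : ℝ) * t * Complex.I)).re =
      ∑ j ∈ s, p j * Real.cos (j * t) := by
    rw [Complex.re_sum]
    refine Finset.sum_congr rfl fun j _ => ?_
    rw [Complex.smul_re, ← Complex.ofReal_mul, Complex.exp_ofReal_mul_I_re, smul_eq_mul]
  have him : (∑ j ∈ s, p j • Complex.exp ((j : ℝ) * t * Complex.I)).im =
      ∑ j ∈ s, p j * Real.sin (j * t) := by
    rw [Complex.im_sum]
    refine Finset.sum_congr rfl fun j _ => ?_
    rw [Complex.smul_im, ← Complex.ofReal_mul, Complex.exp_ofReal_mul_I_im, smul_eq_mul]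
  rw [Complex.sq_norm, Complex.normSq_apply, hre, him, sq, Finset.sum_mul_sum, Finset.sum_mul_sum,
    Finset.sum_mul_sum, Finset.mul_sum, ← Finset.sum_add_distrib, ← Finset.sum_sub_distrib]
  refine Finset.sum_congr rfl fun j _ => ?_
  rw [Finset.mul_sum, ← Finset.sum_add_distrib, ← Finset.sum_sub_distrib]
  refine Finset.sum_congr rfl fun k _ => ?_
  have h := sq_mul_cosDefect (j - k) t
  have h2 : Real.cos ((j - k : ℤ) * t) =
      Real.cos (j * t) * Real.cos (k * t) + Real.sin (j * t) * Real.sin (k * t) := by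
    rw [← Real.cos_sub]; push_cast; ring_nf
  rw [h2] at h
  linear_combination p j * p k * h

/-- Probability measures on `ℤ` with bounded first moment which do not concentrate on cosets have
characteristic functions uniformly dominated by a Gaussian on `[-π, π]`. -/
theorem exists_norm_fourierMoment_zero_le (a : ℝ) {ρ : ℝ} (hρ : ρ < 1) :
    ∃ c : ℝ, 0 < c ∧ ∀ μ : Measure ℤ, IsProbabilityMeasure μ →
      Integrable (fun k : ℤ => |(k : ℝ)|) μ → ∫ k : ℤ, |(k : ℝ)| ∂μ ≤ a →
      (∀ β α : ℤ, 2 ≤ β → μ.real {k : ℤ | ∃ j : ℤ, k = β * j + α} ≤ ρ) →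
      ∀ t : ℝ, |t| ≤ Real.pi → ‖fourierMoment 0 μ t‖ ≤ Real.exp (-c * t ^ 2) := by
  set r := max ρ 0 with hr
  have hr1 : r < 1 := max_lt hρ one_pos
  have hr0 : 0 ≤ r := le_max_right _ _
  obtain ⟨K, hK⟩ := exists_nat_gt (2 * a / (1 - r))
  have hK' : a < (1 - r) / 2 * (K + 1) := by
    rw [div_lt_iff₀ (by linarith)] at hK
    nlinarith
  set s : Finset ℤ := Finset.Icc (-K) K with hs
  obtain ⟨c, hc, hcs⟩ := exists_pos_le_sum_cosDefect s (q := (1 + r) / 2) (ρ := ρ)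
    (by linarith) (by linarith [le_max_left ρ 0])
  refine ⟨c / 2, by positivity, fun μ hμ hint ha hco t ht => ?_⟩
  have hP : μ.real s + μ.real (s : Set ℤ)ᶜ = 1 := by
    simp [measureReal_add_measureReal_compl (μ := μ) (s := (s : Set ℤ)) s.measurableSet]
  have hsum : ∑ j ∈ s, μ.real {j} = μ.real s := by simp
  -- Markov's inequality
  have htail : μ.real (s : Set ℤ)ᶜ ≤ (1 - r) / 2 := by
    have h1 : (K + 1 : ℝ) * μ.real {k : ℤ | (K + 1 : ℝ) ≤ |(k : ℝ)|} ≤ ∫ k : ℤ, |(k : ℝ)| ∂μ :=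
      mul_meas_ge_le_integral_of_nonneg (ae_of_all _ fun k => abs_nonneg _) hint _
    have h2 : (s : Set ℤ)ᶜ = {k : ℤ | (K + 1 : ℝ) ≤ |(k : ℝ)|} := by
      ext k
      simp only [hs, Set.mem_compl_iff, Finset.mem_coe, Finset.mem_Icc, Set.mem_ofPred_eq, ← abs_le]
      rw [not_le, ← Int.add_one_le_iff]
      exact_mod_cast Iff.rfl
    rw [← h2] at h1
    have h3 : (0 : ℝ) < K + 1 := by positivity
    by_contra! h4
    nlinarith
  have hmem : (fun j => μ.real {j}) ∈ spreadWeights s ((1 + r) / 2) ρ := by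
    refine ⟨⟨fun j _ => ⟨measureReal_nonneg, measureReal_le_one⟩, ?_⟩, ?_⟩
    · change _ ≤ ∑ j ∈ s, μ.real {j}
      linarith
    · simp only [Set.mem_iInter]
      intro β α hβ
      refine le_trans ?_ (hco β α hβ)
      change ∑ j ∈ s with β ∣ j - α, μ.real {j} ≤ _
      rw [sum_measureReal_singleton]
      refine measureReal_mono fun j hj => ?_
      simp only [Finset.coe_filter, Set.mem_ofPred_eq] at hj
      obtain ⟨i, hi⟩ := hj.2
      exact ⟨i, by omega⟩
  have hG := hcs _ hmem t ht
  have hsplit : ‖fourierMoment 0 μ t‖ ≤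
      ‖∑ j ∈ s, μ.real {j} • Complex.exp ((j : ℝ) * t * Complex.I)‖ + μ.real (s : Set ℤ)ᶜ := by
    have hi : Integrable (fun k : ℤ => Complex.exp ((k : ℝ) * t * Complex.I)) μ :=
      (integrable_const (1 : ℝ)).mono' (by fun_prop)
        (ae_of_all _ fun k => (norm_exp_int_mul_I k t).le)
    have : fourierMoment 0 μ t = ∫ k : ℤ, Complex.exp ((k : ℝ) * t * Complex.I) ∂μ := by
      simp [fourierMoment]
    rw [this, ← integral_add_compl s.measurableSet hi, setIntegral_finset _ hi.integrableOn]
    refine (norm_add_le _ _).trans (add_le_add le_rfl ?_)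
    simpa using norm_setIntegral_le_of_norm_le_const (μ := μ) (C := 1) (s := (s : Set ℤ)ᶜ)
      (measure_lt_top _ _) (fun k _ => (norm_exp_int_mul_I k t).le)
  have hsq := sq_norm_sum_mul_exp s (fun j => μ.real {j}) t
  set N := ‖∑ j ∈ s, μ.real {j} • Complex.exp ((j : ℝ) * t * Complex.I)‖
  set G := ∑ j ∈ s, ∑ k ∈ s, μ.real {j} * μ.real {k} * cosDefect (j - k) t
  rw [hsum] at hsq
  have hP1 : μ.real (s : Set ℤ) ≤ 1 := measureReal_le_one
  have hP0 : 0 ≤ μ.real (s : Set ℤ) := measureReal_nonneg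
  have hN0 : 0 ≤ N := norm_nonneg _
  have hN : N ≤ μ.real (s : Set ℤ) - c / 2 * t ^ 2 := by
    have hcG : c * t ^ 2 ≤ t ^ 2 * G := by nlinarith [sq_nonneg t]
    have hnn : 0 ≤ μ.real (s : Set ℤ) - c / 2 * t ^ 2 := by nlinarith [sq_nonneg N]
    refine (pow_le_pow_iff_left₀ hN0 hnn two_ne_zero).1 ?_
    nlinarith [sq_nonneg (c / 2 * t ^ 2), mul_nonneg hc.le (sq_nonneg t)]
  calc ‖fourierMoment 0 μ t‖ ≤ 1 - c / 2 * t ^ 2 := by linarith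
    _ ≤ Real.exp (-(c / 2) * t ^ 2) := by linarith [Real.add_one_le_exp (-(c / 2) * t ^ 2)]

/-! ### Local bounds for convolution products -/

theorem isProbabilityMeasure_convProd {ν : ℕ → Measure ℤ} (hν : ∀ n, IsProbabilityMeasure (ν n)) :
    ∀ n, IsProbabilityMeasure (convProd ν n)
  | 0 => by rw [convProd]; infer_instance
  | n + 1 => by
    have := isProbabilityMeasure_convProd hν n
    rw [convProd]; infer_instance

theorem integrable_sq_convProd {ν : ℕ → Measure ℤ} (hν : ∀ n, IsProbabilityMeasure (ν n))
    (h2 : ∀ n, Integrable (fun k : ℤ => (k : ℝ) ^ 2) (ν n)) :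
    ∀ n, Integrable (fun k : ℤ => (k : ℝ) ^ 2) (convProd ν n)
  | 0 => by rw [convProd]; exact integrable_dirac (by simp)
  | n + 1 => by
    have := isProbabilityMeasure_convProd hν n
    rw [convProd]; exact integrable_sq_conv (integrable_sq_convProd hν h2 n) (h2 n)

theorem norm_fourierMoment_zero_convProd_le {ν : ℕ → Measure ℤ}
    (hν : ∀ n, IsProbabilityMeasure (ν n)) {q t : ℝ}
    (hq : ∀ n, ‖fourierMoment 0 (ν n) t‖ ≤ q) (n : ℕ) :
    ‖fourierMoment 0 (convProd ν n) t‖ ≤ q ^ n := by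
  have hq0 : 0 ≤ q := (norm_nonneg _).trans (hq 0)
  induction n with
  | zero => simp [convProd, fourierMoment]
  | succ n ih =>
    have := isProbabilityMeasure_convProd hν n
    rw [convProd, fourierMoment_zero_conv, norm_mul, pow_succ]
    exact mul_le_mul ih (hq n) (norm_nonneg _) (by positivity)

/-- The factor `K ≥ q⁻¹` compensates for the one factor `q` lost by differentiating the product. -/
theorem norm_fourierMoment_one_convProd_le {ν : ℕ → Measure ℤ}
    (hν : ∀ n, IsProbabilityMeasure (ν n)) (h2 : ∀ n, Integrable (fun k : ℤ => (k : ℝ) ^ 2) (ν n))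
    (h0 : ∀ n, ∫ k : ℤ, (k : ℝ) ∂(ν n) = 0) {q t K : ℝ}
    (hq : ∀ n, ‖fourierMoment 0 (ν n) t‖ ≤ q) (hK : 1 ≤ q * K) (n : ℕ) :
    ‖fourierMoment 1 (convProd ν n) t‖ ≤
      |t| * (∑ i ∈ Finset.range n, ∫ k : ℤ, (k : ℝ) ^ 2 ∂(ν i)) * K * q ^ n := by
  have hq0 : 0 ≤ q := (norm_nonneg _).trans (hq 0)
  have hK0 : 0 ≤ K := by
    by_contra! h
    nlinarith
  induction n with
  | zero => simp [convProd, fourierMoment]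
  | succ n ih =>
    have := isProbabilityMeasure_convProd hν n
    rw [convProd, fourierMoment_one_conv (integrable_sq_convProd hν h2 n) (h2 n),
      Finset.sum_range_succ]
    set V := ∑ i ∈ Finset.range n, ∫ k : ℤ, (k : ℝ) ^ 2 ∂(ν i)
    set v := ∫ k : ℤ, (k : ℝ) ^ 2 ∂(ν n)
    have hv : 0 ≤ v := integral_nonneg fun k => sq_nonneg _
    have hV : 0 ≤ V := Finset.sum_nonneg fun i _ => integral_nonneg fun k => sq_nonneg _
    have hz := norm_fourierMoment_zero_convProd_le hν hq n
    have ho := norm_fourierMoment_one_le (h2 n) (h0 n) t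
    refine (norm_add_le _ _).trans ?_
    rw [norm_mul, norm_mul]
    calc _ ≤ (|t| * V * K * q ^ n) * q + q ^ n * (|t| * v) := by
          gcongr
          exact hq n
      _ ≤ (|t| * V * K * q ^ n) * q + (q * K) * (q ^ n * (|t| * v)) := by
          linarith [le_mul_of_one_le_left (show 0 ≤ q ^ n * (|t| * v) by positivity) hK]
      _ = _ := by ring

theorem norm_fourierMoment_two_convProd_le {ν : ℕ → Measure ℤ}
    (hν : ∀ n, IsProbabilityMeasure (ν n)) (h2 : ∀ n, Integrable (fun k : ℤ => (k : ℝ) ^ 2) (ν n))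
    (h0 : ∀ n, ∫ k : ℤ, (k : ℝ) ∂(ν n) = 0) {q t K : ℝ}
    (hq : ∀ n, ‖fourierMoment 0 (ν n) t‖ ≤ q) (hK : 1 ≤ q * K) (n : ℕ) :
    ‖fourierMoment 2 (convProd ν n) t‖ ≤
      ((∑ i ∈ Finset.range n, ∫ k : ℤ, (k : ℝ) ^ 2 ∂(ν i)) * K +
        (|t| * (∑ i ∈ Finset.range n, ∫ k : ℤ, (k : ℝ) ^ 2 ∂(ν i)) * K) ^ 2) * q ^ n := by
  have hq0 : 0 ≤ q := (norm_nonneg _).trans (hq 0)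
  have hK0 : 0 ≤ K := by
    by_contra! h
    nlinarith
  induction n with
  | zero => simp [convProd, fourierMoment]
  | succ n ih =>
    have := isProbabilityMeasure_convProd hν n
    have hone := norm_fourierMoment_one_convProd_le hν h2 h0 hq hK n
    rw [convProd, fourierMoment_two_conv (integrable_sq_convProd hν h2 n) (h2 n),
      Finset.sum_range_succ]
    set V := ∑ i ∈ Finset.range n, ∫ k : ℤ, (k : ℝ) ^ 2 ∂(ν i)
    set v := ∫ k : ℤ, (k : ℝ) ^ 2 ∂(ν n)
    have hv : 0 ≤ v := integral_nonneg fun k => sq_nonneg _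
    have hV : 0 ≤ V := Finset.sum_nonneg fun i _ => integral_nonneg fun k => sq_nonneg _
    have hz := norm_fourierMoment_zero_convProd_le hν hq n
    have ho := norm_fourierMoment_one_le (h2 n) (h0 n) t
    have ht := norm_fourierMoment_two_le (ν n) t
    have h3 : ‖(2 : ℂ)‖ = 2 := by simp
    refine (norm_add₃_le).trans ?_
    rw [norm_mul, norm_mul, norm_mul, norm_mul, h3]
    calc _ ≤ ((V * K + (|t| * V * K) ^ 2) * q ^ n) * q + 2 * ((|t| * V * K * q ^ n) * (|t| * v))
          + q ^ n * v := by
          gcongr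
          exact hq n
      _ ≤ ((V * K + (|t| * V * K) ^ 2) * q ^ n) * q
          + (q * K) * (2 * ((|t| * V * K * q ^ n) * (|t| * v))) + (q * K) * (q ^ n * v) := by
          linarith [le_mul_of_one_le_left (show 0 ≤ q ^ n * v by positivity) hK,
            le_mul_of_one_le_left
              (show 0 ≤ 2 * ((|t| * V * K * q ^ n) * (|t| * v)) by positivity) hK]
      _ ≤ _ := by
          have : 0 ≤ (|t| * v * K) ^ 2 * q ^ (n + 1) := by positivity
          rw [pow_succ q n] at this ⊢
          linarith

theorem integral_exp_neg_mul_sq_le {b : ℝ} (hb : 0 < b) :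
    ∫ t in (-Real.pi)..Real.pi, Real.exp (-b * t ^ 2) ≤ √(Real.pi / b) := by
  rw [← integral_gaussian b, intervalIntegral.integral_of_le (by linarith [Real.pi_pos])]
  exact setIntegral_le_integral (integrable_exp_neg_mul_sq hb)
    (ae_of_all _ fun t => (Real.exp_pos _).le)

theorem norm_integral_le_of_norm_le_gaussian {F : ℝ → ℂ} {A b : ℝ} (hA : 0 ≤ A) (hb : 0 < b)
    (h : ∀ t : ℝ, |t| ≤ Real.pi → ‖F t‖ ≤ A * Real.exp (-b * t ^ 2)) :
    ‖∫ t in (-Real.pi)..Real.pi, F t‖ ≤ A * √(Real.pi / b) := by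
  have hpi : -Real.pi ≤ Real.pi := by linarith [Real.pi_pos]
  calc ‖∫ t in (-Real.pi)..Real.pi, F t‖
      ≤ ∫ t in (-Real.pi)..Real.pi, A * Real.exp (-b * t ^ 2) := by
        refine intervalIntegral.norm_integral_le_of_norm_le hpi (ae_of_all _ fun t ht => ?_) ?_
        · exact h t (abs_le.2 ⟨ht.1.le, ht.2⟩)
        · exact Continuous.intervalIntegrable (by fun_prop) _ _
    _ = A * ∫ t in (-Real.pi)..Real.pi, Real.exp (-b * t ^ 2) :=
        intervalIntegral.integral_const_mul _ _
    _ ≤ _ := by gcongr; exact integral_exp_neg_mul_sq_le hb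

/-- A sequence of probability measures on `ℤ` obeying the local bounds of random walks with
centred increments of bounded variance: the density is `O(min(n^{-1/2}, n^{1/2} k⁻²))` and its
increments are `O(n⁻¹)`. -/
structure DiffusiveBounds (μ : ℕ → Measure ℤ) (C : ℝ) : Prop where
  isProb : ∀ n, IsProbabilityMeasure (μ n)
  pos : 0 < C
  le : ∀ n, 0 < n → ∀ k : ℤ, (μ n).real {k} ≤ C / √n
  sq_mul_le : ∀ n, 0 < n → ∀ k : ℤ, (k : ℝ) ^ 2 * (μ n).real {k} ≤ C * √n
  abs_sub_le : ∀ n, 0 < n → ∀ k : ℤ, |(μ n).real {k} - (μ n).real {k + 1}| ≤ C / n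

theorem exists_diffusiveBounds_convProd {ν : ℕ → Measure ℤ}
    (hν : ∀ n, IsProbabilityMeasure (ν n)) (h2 : ∀ n, Integrable (fun k : ℤ => (k : ℝ) ^ 2) (ν n))
    (h0 : ∀ n, ∫ k : ℤ, (k : ℝ) ∂(ν n) = 0) {c : ℝ} (hc : 0 < c)
    (hchar : ∀ n, ∀ t : ℝ, |t| ≤ Real.pi → ‖fourierMoment 0 (ν n) t‖ ≤ Real.exp (-c * t ^ 2))
    {M : ℝ} (hM : 0 ≤ M)
    (hV : ∀ n : ℕ, ∑ i ∈ Finset.range n, ∫ k : ℤ, (k : ℝ) ^ 2 ∂(ν i) ≤ M * n) :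
    ∃ C : ℝ, DiffusiveBounds (convProd ν) C := by
  set K := Real.exp (c * Real.pi ^ 2) with hKdef
  have hK : ∀ t : ℝ, |t| ≤ Real.pi → 1 ≤ Real.exp (-c * t ^ 2) * K := fun t ht => by
    rw [hKdef, ← Real.exp_add, Real.one_le_exp_iff]
    have : t ^ 2 ≤ Real.pi ^ 2 := sq_le_sq.2 (by rwa [abs_of_pos Real.pi_pos])
    nlinarith
  have hK0 : 0 < K := Real.exp_pos _
  set g := √(Real.pi / (c / 2)) with hg
  have hg0 : 0 < g := Real.sqrt_pos.2 (by have := Real.pi_pos; positivity)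
  set D := M * K + 2 / c * (M * K) ^ 2 with hD
  have hD0 : 0 ≤ D := by positivity
  have hpi := Real.pi_gt_three
  have hpr := isProbabilityMeasure_convProd hν
  have hexp : ∀ (n : ℕ) (t : ℝ), Real.exp (-c * t ^ 2) ^ n =
      Real.exp (-(c * n / 2 * t ^ 2)) * Real.exp (-(c / 2 * n) * t ^ 2) := fun n t => by
    rw [← Real.exp_nat_mul, ← Real.exp_add]; congr 1; ring
  have hgn : ∀ n : ℕ, 0 < n → √(Real.pi / (c / 2 * n)) = g / √n := fun n hn => by
    rw [← div_div, Real.sqrt_div' _ (by positivity)]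
  have hbn : ∀ n : ℕ, 0 < n → 0 < c / 2 * n := fun n hn => by positivity
  have hA : ∀ (n : ℕ) (t : ℝ), |t| ≤ Real.pi →
      ‖fourierMoment 0 (convProd ν n) t‖ ≤ Real.exp (-c * t ^ 2) ^ n := fun n t ht =>
    norm_fourierMoment_zero_convProd_le hν (fun i => hchar i t ht) n
  have hinv : ∀ (n p : ℕ) (_ : p ≤ 2) (k : ℤ), |(k : ℝ) ^ p * (convProd ν n).real {k}| ≤
      ‖∫ t in (-Real.pi)..Real.pi, fourierMoment p (convProd ν n) t *
        Complex.exp (((-k : ℤ) : ℝ) * t * Complex.I)‖ := fun n p hp k => by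
    rw [integral_fourierMoment_mul_exp (integrable_sq_convProd hν h2 n) hp]
    have : (2 * Real.pi * ((k : ℂ) ^ p * (convProd ν n).real {k}) : ℂ) =
      ((2 * Real.pi * ((k : ℝ) ^ p * (convProd ν n).real {k}) : ℝ) : ℂ) := by push_cast; ring
    rw [this, Complex.norm_real, Real.norm_eq_abs, abs_mul (2 * Real.pi),
      abs_of_pos (show 0 < 2 * Real.pi by positivity)]
    exact le_mul_of_one_le_left (abs_nonneg _) (by linarith)
  have hn0 : ∀ n : ℕ, 0 < n → 0 < √(n : ℝ) := fun n hn => Real.sqrt_pos.2 (by exact_mod_cast hn)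
  refine ⟨g * (1 + D + 1 / √c), hpr, by positivity, fun n hn k => ?_, fun n hn k => ?_,
    fun n hn k => ?_⟩
  · have h := hinv n 0 (by norm_num) k
    rw [pow_zero, one_mul, abs_of_nonneg measureReal_nonneg] at h
    refine h.trans ((norm_integral_le_of_norm_le_gaussian (A := 1) zero_le_one (hbn n hn)
      fun t ht => ?_).trans ?_)
    · rw [norm_mul, norm_exp_int_mul_I, mul_one]
      refine (hA n t ht).trans ?_
      rw [hexp]
      gcongr
      rw [Real.exp_le_one_iff, neg_nonpos]; positivity
    · rw [hgn n hn, one_mul]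
      gcongr
      exact le_mul_of_one_le_right hg0.le (by linarith [show 0 ≤ 1 / √c by positivity])
  · have h := hinv n 2 le_rfl k
    rw [abs_of_nonneg (mul_nonneg (sq_nonneg _) measureReal_nonneg)] at h
    refine h.trans ((norm_integral_le_of_norm_le_gaussian (A := n * D) (by positivity) (hbn n hn)
      fun t ht => ?_).trans ?_)
    · rw [norm_mul, norm_exp_int_mul_I, mul_one]
      refine (norm_fourierMoment_two_convProd_le hν h2 h0 (fun i => hchar i t ht) (hK t ht)
        n).trans ?_
      rw [hexp, ← mul_assoc]
      refine mul_le_mul_of_nonneg_right ?_ (Real.exp_pos _).le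
      set V := ∑ i ∈ Finset.range n, ∫ k : ℤ, (k : ℝ) ^ 2 ∂(ν i)
      have hVn : V ≤ M * n := hV n
      have hV0 : 0 ≤ V := Finset.sum_nonneg fun i _ => integral_nonneg fun k => sq_nonneg _
      set x := c * n / 2 * t ^ 2 with hx
      have hx0 : 0 ≤ x := by positivity
      have he1 : Real.exp (-x) ≤ 1 := by rw [Real.exp_le_one_iff]; linarith
      -- `x e^{-x} ≤ 1` absorbs the factor `n t²`
      have he2 : x * Real.exp (-x) ≤ 1 := by
        rw [Real.exp_neg, ← div_eq_mul_inv, div_le_one (Real.exp_pos _)]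
        linarith [Real.add_one_le_exp x]
      calc (V * K + (|t| * V * K) ^ 2) * Real.exp (-x)
          ≤ (M * n * K + (|t| * (M * n) * K) ^ 2) * Real.exp (-x) := by gcongr
        _ = M * n * K * Real.exp (-x) + n * (2 / c * (M * K) ^ 2) * (x * Real.exp (-x)) := by
            rw [hx, mul_pow, mul_pow, sq_abs]; field_simp
        _ ≤ M * n * K * 1 + n * (2 / c * (M * K) ^ 2) * 1 := by gcongr
        _ = n * D := by rw [hD]; ring
    · rw [hgn n hn]
      have hs : (n : ℝ) = √n * √n := (Real.mul_self_sqrt (Nat.cast_nonneg n)).symm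
      have : n * D * (g / √n) = g * D * √n := by
        have := (hn0 n hn).ne'
        nth_rw 1 [hs]; field_simp
      rw [this]
      gcongr
      have : 0 ≤ 1 / √c := by positivity
      linarith
  · have hI : ∀ j : ℤ, IntervalIntegrable (fun t : ℝ => fourierMoment 0 (convProd ν n) t *
        Complex.exp (((-j : ℤ) : ℝ) * t * Complex.I)) volume (-Real.pi) Real.pi := fun j =>
      (continuous_fourierMoment.mul (by fun_prop)).intervalIntegrable _ _
    have heq : |(convProd ν n).real {k} - (convProd ν n).real {k + 1}| ≤
        ‖∫ t in (-Real.pi)..Real.pi, (fourierMoment 0 (convProd ν n) t *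
          Complex.exp (((-k : ℤ) : ℝ) * t * Complex.I) - fourierMoment 0 (convProd ν n) t *
          Complex.exp (((-(k + 1) : ℤ) : ℝ) * t * Complex.I))‖ := by
      rw [intervalIntegral.integral_sub (hI k) (hI (k + 1)),
        integral_fourierMoment_mul_exp (integrable_sq_convProd hν h2 n) (by norm_num),
        integral_fourierMoment_mul_exp (integrable_sq_convProd hν h2 n) (by norm_num)]
      have : (2 * Real.pi * ((k : ℂ) ^ 0 * (convProd ν n).real {k}) -
          2 * Real.pi * (((k + 1 : ℤ) : ℂ) ^ 0 * (convProd ν n).real {k + 1}) : ℂ) =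
        ((2 * Real.pi * ((convProd ν n).real {k} - (convProd ν n).real {k + 1}) : ℝ) : ℂ) := by
        push_cast; ring
      rw [this, Complex.norm_real, Real.norm_eq_abs, abs_mul,
        abs_of_pos (show 0 < 2 * Real.pi by positivity)]
      exact le_mul_of_one_le_left (abs_nonneg _) (by linarith)
    have hcn : 0 < √(c * n) := Real.sqrt_pos.2 (by positivity)
    refine heq.trans ((norm_integral_le_of_norm_le_gaussian (A := 1 / √(c * n)) (by positivity)
      (hbn n hn) fun t ht => ?_).trans ?_)
    · rw [← mul_sub, norm_mul]
      have hd : ‖Complex.exp (((-k : ℤ) : ℝ) * t * Complex.I) -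
          Complex.exp (((-(k + 1) : ℤ) : ℝ) * t * Complex.I)‖ ≤ |t| := by
        rw [show -k = -(k + 1) + 1 by ring, exp_int_mul_I_add, ← mul_sub_one, norm_mul,
          norm_exp_int_mul_I, one_mul]
        have := Real.norm_exp_I_mul_ofReal_sub_one_le (x := t)
        rw [mul_comm] at this
        simpa using this
      refine (mul_le_mul (hA n t ht) hd (norm_nonneg _) (by positivity)).trans ?_
      rw [hexp, mul_right_comm]
      gcongr
      rw [le_div_iff₀ hcn, Real.exp_neg, mul_assoc, ← div_eq_inv_mul, div_le_one (Real.exp_pos _)]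
      -- `y ≤ e^{y²/2}` with `y = |t| √(c n)`
      have hy : (|t| * √(c * n)) ^ 2 = c * n * t ^ 2 := by
        rw [mul_pow, sq_abs, Real.sq_sqrt (by positivity)]; ring
      have := Real.add_one_le_exp (c * n / 2 * t ^ 2)
      nlinarith [sq_nonneg (|t| * √(c * n) - 1)]
    · rw [hgn n hn, Real.sqrt_mul hc.le]
      have hs : (n : ℝ) = √n * √n := (Real.mul_self_sqrt (Nat.cast_nonneg n)).symm
      have : 1 / (√c * √n) * (g / √n) = g * (1 / √c) / n := by
        have := (hn0 n hn).ne'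
        have := (Real.sqrt_pos.2 hc).ne'
        nth_rw 3 [hs]; field_simp
      rw [this]
      gcongr
      linarith

/-! ### The maximal ergodic theorem and dyadic domination -/

/-- `maxBirkhoffSum T φ N x` is the largest of `0, S₁ x, …, S_N x`, where `S_n` is the `n`-th
Birkhoff sum of `φ`, defined by the recursion that drives the proof of the maximal ergodic
theorem. -/
def maxBirkhoffSum {X : Type*} (T : X → X) (φ : X → ℝ) : ℕ → X → ℝ
  | 0, _ => 0
  | N + 1, x => max 0 (φ x + maxBirkhoffSum T φ N (T x))

section Maximal

variable {X : Type*}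

theorem maxBirkhoffSum_nonneg (T : X → X) (φ : X → ℝ) (N : ℕ) (x : X) :
    0 ≤ maxBirkhoffSum T φ N x := by
  cases N with
  | zero => exact le_rfl
  | succ N => exact le_max_left _ _

theorem maxBirkhoffSum_le_succ (T : X → X) (φ : X → ℝ) (N : ℕ) (x : X) :
    maxBirkhoffSum T φ N x ≤ maxBirkhoffSum T φ (N + 1) x := by
  induction N generalizing x with
  | zero => exact maxBirkhoffSum_nonneg T φ 1 x
  | succ N ih => exact max_le_max le_rfl (add_le_add le_rfl (ih (T x)))

theorem birkhoffSum_le_maxBirkhoffSum (T : X → X) (φ : X → ℝ) (N : ℕ) (x : X) :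
    birkhoffSum T φ N x ≤ maxBirkhoffSum T φ N x := by
  induction N generalizing x with
  | zero => simp [maxBirkhoffSum]
  | succ N ih =>
    rw [birkhoffSum_succ']
    exact (add_le_add le_rfl (ih (T x))).trans (le_max_right _ _)

variable [MeasurableSpace X] {m : Measure X} {T : X → X}

theorem measurable_maxBirkhoffSum (hT : Measurable T) {φ : X → ℝ} (hφ : Measurable φ) (N : ℕ) :
    Measurable (maxBirkhoffSum T φ N) := by
  induction N with
  | zero => exact measurable_const
  | succ N ih => exact measurable_const.max (hφ.add (ih.comp hT))

theorem integrable_maxBirkhoffSum (hT : MeasurePreserving T m m) {φ : X → ℝ}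
    (hφ : Integrable φ m) (N : ℕ) : Integrable (maxBirkhoffSum T φ N) m := by
  induction N with
  | zero => exact integrable_zero _ _ _
  | succ N ih =>
    exact (integrable_zero _ _ _).sup (hφ.add (hT.integrable_comp_of_integrable ih))

/-- The maximal ergodic theorem, by Garsia's argument. -/
theorem setIntegral_maxBirkhoffSum_pos_nonneg (hT : MeasurePreserving T m m) {φ : X → ℝ}
    (hφm : Measurable φ) (hφ : Integrable φ m) (N : ℕ) :
    0 ≤ ∫ x in {x | 0 < maxBirkhoffSum T φ N x}, φ x ∂m := by
  cases N with
  | zero => simp [maxBirkhoffSum]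
  | succ N =>
    set F := maxBirkhoffSum T φ (N + 1) with hF
    have hFi : Integrable F m := integrable_maxBirkhoffSum hT hφ _
    have hFT : Integrable (fun x => F (T x)) m := hT.integrable_comp_of_integrable hFi
    have hE : MeasurableSet {x | 0 < F x} :=
      measurableSet_lt measurable_const (measurable_maxBirkhoffSum hT.measurable hφm _)
    have h1 : ∫ x in {x | 0 < F x}, F x ∂m = ∫ x, F x ∂m := by
      refine setIntegral_eq_integral_of_forall_compl_eq_zero fun x hx => ?_
      exact le_antisymm (not_lt.1 hx) (maxBirkhoffSum_nonneg _ _ _ _)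
    have h2 : ∫ x in {x | 0 < F x}, F (T x) ∂m ≤ ∫ x, F (T x) ∂m :=
      setIntegral_le_integral hFT (ae_of_all _ fun x => maxBirkhoffSum_nonneg _ _ _ _)
    have h3 : ∫ x, F (T x) ∂m = ∫ x, F x ∂m := by
      have := integral_map (μ := m) hT.measurable.aemeasurable (f := F)
        (by rw [hT.map_eq]; exact hFi.aestronglyMeasurable)
      rw [hT.map_eq] at this
      exact this.symm
    have h4 : ∫ x in {x | 0 < F x}, (F x - F (T x)) ∂m ≤ ∫ x in {x | 0 < F x}, φ x ∂m := by
      refine setIntegral_mono_on (hFi.sub hFT).integrableOn hφ.integrableOn hE fun x hx => ?_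
      have hx' : 0 < max 0 (φ x + maxBirkhoffSum T φ N (T x)) := hx
      have h5 : F x = φ x + maxBirkhoffSum T φ N (T x) :=
        max_eq_right (le_of_lt ((lt_max_iff.1 hx').resolve_left (lt_irrefl _)))
      linarith [maxBirkhoffSum_le_succ T φ N (T x)]
    rw [integral_sub hFi.integrableOn hFT.integrableOn] at h4
    linarith

/-- Weak type `(1,1)` inequality for the ergodic maximal function. -/
theorem measure_exists_lt_birkhoffSum_le [IsFiniteMeasure m] (hT : MeasurePreserving T m m)
    {g : X → ℝ} (hgm : Measurable g) (hg : Integrable g m) (hg0 : 0 ≤ g) {l : ℝ} (hl : 0 < l) :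
    m {x | ∃ n : ℕ, n * l < birkhoffSum T g n x} ≤ ENNReal.ofReal ((∫ x, g x ∂m) / l) := by
  set φ : X → ℝ := fun x => g x - l with hφ
  have hφm : Measurable φ := hgm.sub_const l
  have hφi : Integrable φ m := hg.sub (integrable_const l)
  have hmono : Monotone fun N => {x | 0 < maxBirkhoffSum T φ N x} :=
    monotone_nat_of_le_succ fun N x hx => lt_of_lt_of_le hx (maxBirkhoffSum_le_succ T φ N x)
  have hsub : {x | ∃ n : ℕ, n * l < birkhoffSum T g n x} ⊆
      ⋃ N, {x | 0 < maxBirkhoffSum T φ N x} := by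
    rintro x ⟨n, hn⟩
    refine Set.mem_iUnion.2 ⟨n, lt_of_lt_of_le ?_ (birkhoffSum_le_maxBirkhoffSum T φ n x)⟩
    have : birkhoffSum T φ n x = birkhoffSum T g n x - n * l := by
      simp [birkhoffSum, hφ, Finset.sum_sub_distrib]
    rw [this]; linarith
  refine (measure_mono hsub).trans ?_
  rw [hmono.measure_iUnion]
  refine iSup_le fun N => ?_
  set E := {x | 0 < maxBirkhoffSum T φ N x}
  have h := setIntegral_maxBirkhoffSum_pos_nonneg hT hφm hφi N
  rw [integral_sub hg.integrableOn (integrable_const l).integrableOn, setIntegral_const,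
    smul_eq_mul] at h
  have h2 : ∫ x in E, g x ∂m ≤ ∫ x, g x ∂m := setIntegral_le_integral hg (ae_of_all _ hg0)
  rw [← ofReal_measureReal]
  refine ENNReal.ofReal_le_ofReal ?_
  rw [le_div_iff₀ hl]
  linarith

end Maximal

/-- A kernel bounded by `C min(R⁻¹, R k⁻²)` averages a function with bounded symmetric means
boundedly, uniformly in the scale `R`: decompose `ℤ` into the dyadic annuli
`2ⁱR < |k| ≤ 2ⁱ⁺¹R`. -/
theorem sum_mul_le_of_symmetric_means_le {w G : ℤ → ℝ} {C R l : ℝ} (hw : ∀ k, 0 ≤ w k)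
    (hG : ∀ k, 0 ≤ G k) (hR : 1 ≤ R) (hC : 0 ≤ C) (hl : 0 ≤ l) (h1 : ∀ k, w k ≤ C / R)
    (h2 : ∀ k : ℤ, (k : ℝ) ^ 2 * w k ≤ C * R)
    (hmean : ∀ N : ℕ, ∑ k ∈ Finset.Icc (-(N : ℤ)) N, G k ≤ (2 * N + 2) * l) (s : Finset ℤ) :
    ∑ k ∈ s, w k * G k ≤ 16 * C * l := by
  have hR0 : 0 < R := by linarith
  set N : ℕ → ℕ := fun i => ⌊2 ^ i * R⌋₊ with hN
  have hNle : ∀ i, (N i : ℝ) ≤ 2 ^ i * R := fun i => Nat.floor_le (by positivity)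
  have hNlt : ∀ i, 2 ^ i * R < N i + 1 := fun i => Nat.lt_floor_add_one _
  have hNmono : Monotone N := monotone_nat_of_le_succ fun i => Nat.floor_mono (by
    rw [pow_succ]; nlinarith [show (0 : ℝ) < 2 ^ i * R by positivity])
  have key : ∀ i, ∑ k ∈ Finset.Icc (-(N i : ℤ)) (N i), w k * G k ≤
      C * l * (16 - 12 * (1 / 2) ^ i) := by
    intro i
    induction i with
    | zero =>
      calc ∑ k ∈ Finset.Icc (-(N 0 : ℤ)) (N 0), w k * G k
          ≤ ∑ k ∈ Finset.Icc (-(N 0 : ℤ)) (N 0), C / R * G k :=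
            Finset.sum_le_sum fun k _ => mul_le_mul_of_nonneg_right (h1 k) (hG k)
        _ = C / R * ∑ k ∈ Finset.Icc (-(N 0 : ℤ)) (N 0), G k := by rw [Finset.mul_sum]
        _ ≤ C / R * ((2 * (2 ^ 0 * R) + 2 * R) * l) := by
            refine mul_le_mul_of_nonneg_left ((hmean _).trans ?_) (by positivity)
            refine mul_le_mul_of_nonneg_right ?_ hl
            linarith [hNle 0]
        _ = C * l * (16 - 12 * (1 / 2) ^ 0) := by field_simp; ring
    | succ i ih =>
      have hsub : Finset.Icc (-(N i : ℤ)) (N i) ⊆ Finset.Icc (-(N (i + 1) : ℤ)) (N (i + 1)) := by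
        have : (N i : ℤ) ≤ N (i + 1) := by exact_mod_cast hNmono (Nat.le_succ i)
        exact Finset.Icc_subset_Icc (by omega) this
      have h2i : (1 : ℝ) ≤ 2 ^ i := one_le_pow₀ (by norm_num)
      rw [← Finset.sum_sdiff hsub]
      have hann : ∀ k ∈ Finset.Icc (-(N (i + 1) : ℤ)) (N (i + 1)) \ Finset.Icc (-(N i : ℤ)) (N i),
          w k ≤ C / (4 ^ i * R) := by
        intro k hk
        have hk' : (N i : ℤ) + 1 ≤ |k| := by
          have := (Finset.mem_sdiff.1 hk).2
          rw [Finset.mem_Icc, ← abs_le, not_le] at this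
          exact this
        have hk2 : 2 ^ i * R ≤ |(k : ℝ)| := by
          refine (hNlt i).le.trans ?_
          exact_mod_cast hk'
        have hk3 : (2 ^ i * R) ^ 2 * w k ≤ C * R := by
          refine le_trans (mul_le_mul_of_nonneg_right ?_ (hw k)) (h2 k)
          rw [← sq_abs (k : ℝ)]
          exact pow_le_pow_left₀ (by positivity) hk2 2
        have h4 : ((2 : ℝ) ^ i) ^ 2 = 4 ^ i := by rw [← pow_mul, mul_comm, pow_mul]; norm_num
        rw [mul_pow, h4] at hk3
        rw [le_div_iff₀ (by positivity)]
        refine le_of_mul_le_mul_right ?_ hR0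
        linarith
      have hdiff : ∑ k ∈ Finset.Icc (-(N (i + 1) : ℤ)) (N (i + 1)) \ Finset.Icc (-(N i : ℤ)) (N i),
          w k * G k ≤ C * l * (6 * (1 / 2) ^ i) := by
        calc _ ≤ ∑ k ∈ Finset.Icc (-(N (i + 1) : ℤ)) (N (i + 1)) \ Finset.Icc (-(N i : ℤ)) (N i),
              C / (4 ^ i * R) * G k :=
              Finset.sum_le_sum fun k hk => mul_le_mul_of_nonneg_right (hann k hk) (hG k)
          _ = C / (4 ^ i * R) * ∑ k ∈ Finset.Icc (-(N (i + 1) : ℤ)) (N (i + 1)) \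
              Finset.Icc (-(N i : ℤ)) (N i), G k := by rw [Finset.mul_sum]
          _ ≤ C / (4 ^ i * R) * ((2 * (2 ^ (i + 1) * R) + 2 * (2 ^ i * R)) * l) := by
              refine mul_le_mul_of_nonneg_left (((Finset.sum_le_sum_of_subset_of_nonneg
                Finset.sdiff_subset fun k _ _ => hG k).trans (hmean _)).trans ?_) (by positivity)
              refine mul_le_mul_of_nonneg_right ?_ hl
              nlinarith [hNle (i + 1)]
          _ = C * l * (6 * (1 / 2) ^ i) := by
              have h4 : (4 : ℝ) ^ i = 2 ^ i * 2 ^ i := by rw [← mul_pow]; norm_num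
              rw [h4, one_div, inv_pow]
              field_simp
              ring
      calc _ ≤ C * l * (6 * (1 / 2) ^ i) + C * l * (16 - 12 * (1 / 2) ^ i) := add_le_add hdiff ih
        _ = _ := by rw [pow_succ]; ring
  obtain ⟨M, hM⟩ : ∃ M : ℕ, ∀ k ∈ s, |k| ≤ M :=
    ⟨∑ k ∈ s, k.natAbs, fun k hk => by
      rw [Int.abs_eq_natAbs]
      exact_mod_cast Finset.single_le_sum (f := Int.natAbs) (fun j _ => Nat.zero_le _) hk⟩
  have hMN : M ≤ N M := Nat.le_floor (by
    have : (M : ℝ) < 2 ^ M := by exact_mod_cast Nat.lt_two_pow_self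
    nlinarith)
  calc ∑ k ∈ s, w k * G k ≤ ∑ k ∈ Finset.Icc (-(N M : ℤ)) (N M), w k * G k := by
        refine Finset.sum_le_sum_of_subset_of_nonneg (fun k hk => ?_)
          fun k _ _ => mul_nonneg (hw k) (hG k)
        rw [Finset.mem_Icc, ← abs_le]
        exact (hM k hk).trans (by exact_mod_cast hMN)
    _ ≤ C * l * (16 - 12 * (1 / 2) ^ M) := key M
    _ ≤ 16 * C * l := by
        have : 0 ≤ C * l * (12 * (1 / 2) ^ M) := by positivity
        linarith

/-! ### Weighted averages along orbits -/

section Orbit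

variable {X : Type*} [MeasurableSpace X] {m : Measure X} {τ : X ≃ᵐ X}

theorem measurePreserving_zpow (hτ : MeasurePreserving τ m m) (k : ℤ) :
    MeasurePreserving (⇑(τ.toEquiv ^ k : Equiv.Perm X)) m m := by
  obtain ⟨n, rfl | rfl⟩ := k.eq_nat_or_neg
  · rw [zpow_natCast, ← Equiv.Perm.iterate_eq_pow]
    exact hτ.iterate n
  · rw [zpow_neg, zpow_natCast, ← inv_pow, ← Equiv.Perm.iterate_eq_pow]
    exact (hτ.symm τ).iterate n

theorem ae_forall_zpow (hτ : MeasurePreserving τ m m) {p : X → Prop} (hp : ∀ᵐ x ∂m, p x) :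
    ∀ᵐ x ∂m, ∀ k : ℤ, p ((τ.toEquiv ^ k : Equiv.Perm X) x) :=
  ae_all_iff.2 fun k => (measurePreserving_zpow hτ k).quasiMeasurePreserving.ae hp

theorem sum_Icc_zpow_le_birkhoffSum {g : X → ℝ} (hg : 0 ≤ g) (x : X) (N : ℕ) :
    ∑ k ∈ Finset.Icc (-(N : ℤ)) N, g ((τ.toEquiv ^ k : Equiv.Perm X) x) ≤
      birkhoffSum τ g (N + 1) x + birkhoffSum τ.symm g (N + 1) x := by
  have hpos : ∀ n : ℕ, (τ.toEquiv ^ (n : ℤ) : Equiv.Perm X) x = τ^[n] x := fun n => by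
    rw [zpow_natCast, ← Equiv.Perm.iterate_eq_pow]; rfl
  have hneg : ∀ n : ℕ, (τ.toEquiv ^ (-(n : ℤ)) : Equiv.Perm X) x = τ.symm^[n] x := fun n => by
    rw [zpow_neg, zpow_natCast, ← inv_pow, ← Equiv.Perm.iterate_eq_pow]; rfl
  induction N with
  | zero => simpa [birkhoffSum] using hg x
  | succ N ih =>
    have hI : Finset.Icc (-((N + 1 : ℕ) : ℤ)) ((N + 1 : ℕ) : ℤ) =
        insert (-((N + 1 : ℕ) : ℤ)) (insert ((N + 1 : ℕ) : ℤ) (Finset.Icc (-(N : ℤ)) N)) := by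
      ext k
      simp only [Finset.mem_insert, Finset.mem_Icc]
      omega
    rw [hI, Finset.sum_insert (by simp; omega), Finset.sum_insert (by simp), hpos, hneg,
      birkhoffSum_succ, birkhoffSum_succ τ.symm]
    linarith

variable {𝕜 : Type*} [RCLike 𝕜] {f g : X → 𝕜} {μ : Measure ℤ} {x : X}

theorem averageTerm_add (k : ℤ) :
    averageTerm τ μ (f + g) x k = averageTerm τ μ f x k + averageTerm τ μ g x k :=
  mul_add _ _ _

theorem norm_averageTerm (k : ℤ) :
    ‖averageTerm τ μ f x k‖ = μ.real {k} * ‖f ((τ.toEquiv ^ k : Equiv.Perm X) x)‖ := by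
  rw [averageTerm, norm_mul, RCLike.norm_ofReal, abs_of_nonneg measureReal_nonneg]

theorem weightedAverage_add (hf : Summable (averageTerm τ μ f x))
    (hg : Summable (averageTerm τ μ g x)) :
    weightedAverage τ μ (f + g) x = weightedAverage τ μ f x + weightedAverage τ μ g x := by
  rw [weightedAverage, weightedAverage, weightedAverage, ← hf.tsum_add hg]
  exact tsum_congr fun k => averageTerm_add k

theorem hasSum_measureReal_singleton (μ : Measure ℤ) [IsProbabilityMeasure μ] :
    HasSum (fun k : ℤ => μ.real {k}) 1 := by
  have h : ∑' k : ℤ, μ {k} = 1 := by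
    simpa using (lintegral_countable' (μ := μ) (fun _ => 1)).symm
  have := ENNReal.hasSum_toReal (f := fun k : ℤ => μ {k}) (by rw [h]; exact ENNReal.one_ne_top)
  simpa [h, ← ENNReal.tsum_toReal_eq, measureReal_def] using this

theorem ae_summable_averageTerm (hτ : MeasurePreserving τ m m) (hf : Integrable f m)
    (μ : Measure ℤ) [IsProbabilityMeasure μ] :
    ∀ᵐ x ∂m, Summable (averageTerm τ μ f x) := by
  have hmeas : ∀ k : ℤ, AEMeasurable (fun x => ‖averageTerm τ μ f x k‖ₑ) m := fun k =>
    ((hf.aestronglyMeasurable.comp_measurePreserving (measurePreserving_zpow hτ k)).const_mul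
      (μ.real {k} : 𝕜)).enorm
  have hint : ∀ k : ℤ, ∫⁻ x, ‖averageTerm τ μ f x k‖ₑ ∂m = μ {k} * ∫⁻ x, ‖f x‖ₑ ∂m := fun k => by
    have h1 : ∀ x, ‖averageTerm τ μ f x k‖ₑ =
        μ {k} * ‖f ((τ.toEquiv ^ k : Equiv.Perm X) x)‖ₑ := fun x => by
      rw [averageTerm, enorm_mul, ← ofReal_norm, RCLike.norm_ofReal,
        abs_of_nonneg measureReal_nonneg, ofReal_measureReal]
    simp_rw [h1]
    rw [lintegral_const_mul' _ _ (measure_ne_top _ _)]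
    congr 1
    have hk := measurePreserving_zpow hτ k
    have h2 := lintegral_map' (μ := m) (f := fun x => ‖f x‖ₑ)
      (by rw [hk.map_eq]; exact hf.aestronglyMeasurable.enorm) hk.measurable.aemeasurable
    rw [hk.map_eq] at h2
    exact h2.symm
  have hfin : ∫⁻ x, ∑' k, ‖averageTerm τ μ f x k‖ₑ ∂m ≠ ∞ := by
    rw [lintegral_tsum hmeas]
    simp_rw [hint]
    rw [ENNReal.tsum_mul_right]
    have h : ∑' k : ℤ, μ {k} = 1 := by
      simpa using (lintegral_countable' (μ := μ) (fun _ => 1)).symm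
    rw [h, one_mul]
    exact hf.2.ne
  filter_upwards [ae_lt_top' (AEMeasurable.tsum hmeas) hfin] with x hx
  exact Summable.of_enorm hx.ne

/-- Weak type `(1,1)` inequality for the maximal function of a diffusive sequence of kernels. -/
theorem measure_exists_lt_norm_weightedAverage_le [IsFiniteMeasure m]
    (hτ : MeasurePreserving τ m m) {μ : ℕ → Measure ℤ} {C : ℝ} (hμ : DiffusiveBounds μ C)
    (hf : Integrable f m) {l : ℝ} (hl : 0 < l) :
    m {x | ∃ n : ℕ, 0 < n ∧ 16 * C * l < ‖weightedAverage τ (μ n) f x‖} ≤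
      2 * ENNReal.ofReal ((∫ x, ‖f x‖ ∂m) / l) := by
  set f' := hf.aestronglyMeasurable.mk f
  have hff' : f =ᵐ[m] f' := hf.aestronglyMeasurable.ae_eq_mk
  set g : X → ℝ := fun x => ‖f' x‖ with hg
  have hgm : Measurable g := hf.aestronglyMeasurable.stronglyMeasurable_mk.norm.measurable
  have hgi : Integrable g m := (hf.congr hff').norm
  have hg0 : 0 ≤ g := fun x => norm_nonneg _
  have hint : ∫ x, ‖f x‖ ∂m = ∫ x, g x ∂m :=
    integral_congr_ae (hff'.mono fun x hx => by simp only [hg, hx])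
  have hsub : ∀ᵐ x ∂m, x ∈ {x | ∃ n : ℕ, 0 < n ∧ 16 * C * l < ‖weightedAverage τ (μ n) f x‖} →
      x ∈ {x | ∃ n : ℕ, n * l < birkhoffSum τ g n x} ∪
        {x | ∃ n : ℕ, n * l < birkhoffSum τ.symm g n x} := by
    filter_upwards [ae_forall_zpow hτ hff'] with x hx
    rintro ⟨n, hn, hlt⟩
    by_contra hnot
    simp only [Set.mem_union, Set.mem_ofPred_eq, not_or, not_exists, not_lt] at hnot
    have hs : ∀ s : Finset ℤ, ∑ k ∈ s, ‖averageTerm τ (μ n) f x k‖ ≤ 16 * C * l := fun s => by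
      have hfg : ∀ k, ‖averageTerm τ (μ n) f x k‖ =
          (μ n).real {k} * g ((τ.toEquiv ^ k : Equiv.Perm X) x) := fun k => by
        rw [norm_averageTerm, hx k]
      simp_rw [hfg]
      refine sum_mul_le_of_symmetric_means_le (R := √n) (fun k => measureReal_nonneg)
        (fun k => hg0 _) ?_ hμ.pos.le hl.le (hμ.le n hn) (hμ.sq_mul_le n hn) (fun N => ?_) s
      · rw [Real.one_le_sqrt]; exact_mod_cast hn
      · refine (sum_Icc_zpow_le_birkhoffSum hg0 x N).trans ?_
        have h1 := hnot.1 (N + 1)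
        have h2 := hnot.2 (N + 1)
        push_cast at h1 h2
        linarith
    have hsum := summable_of_sum_le (fun k => norm_nonneg _) hs
    exact absurd hlt (not_lt.2 ((norm_tsum_le_tsum_norm hsum).trans (hsum.tsum_le_of_sum_le hs)))
  refine (measure_mono_ae hsub).trans ((measure_union_le _ _).trans ?_)
  rw [hint, two_mul]
  exact add_le_add (measure_exists_lt_birkhoffSum_le hτ hgm hgi hg0 hl)
    (measure_exists_lt_birkhoffSum_le (hτ.symm τ) hgm hgi hg0 hl)

/-- The kernels of a diffusive sequence are asymptotically translation invariant in `ℓ¹`: their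
increments are `O(|k|^{-4/3})` uniformly in `n`, and tend to zero pointwise. -/
theorem DiffusiveBounds.tendsto_tsum_abs_sub {μ : ℕ → Measure ℤ} {C : ℝ}
    (hμ : DiffusiveBounds μ C) :
    Tendsto (fun n => ∑' k : ℤ, |(μ n).real {k} - (μ n).real {k + 1}|) atTop (𝓝 0) := by
  have hC := hμ.pos
  set bound : ℤ → ℝ := fun k => 3 * C * |(k : ℝ)| ^ (-(4 / 3 : ℝ)) + if k = 0 then C else 0
  have hb : Summable bound :=
    ((Real.summable_abs_int_rpow (by norm_num)).mul_left _).add (hasSum_ite_eq 0 C).summable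
  have h := tendsto_tsum_of_dominated_convergence (𝓕 := atTop)
    (f := fun (n : ℕ) (k : ℤ) => |(μ n).real {k} - (μ n).real {k + 1}|) (g := fun _ => (0 : ℝ))
    (bound := bound) hb (fun k => ?_) ?_
  · simpa using h
  · refine squeeze_zero' (Eventually.of_forall fun n => abs_nonneg _) ?_
      (tendsto_const_div_atTop_nhds_zero_nat C)
    filter_upwards [eventually_gt_atTop 0] with n hn using hμ.abs_sub_le n hn k
  · filter_upwards [eventually_gt_atTop 0] with n hn k
    have hn1 : (1 : ℝ) ≤ n := by exact_mod_cast hn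
    have hA := hμ.abs_sub_le n hn k
    simp only [Real.norm_eq_abs, abs_abs, bound]
    set A := |(μ n).real {k} - (μ n).real {k + 1}| with hAdef
    have hA0 : 0 ≤ A := abs_nonneg _
    by_cases hk : k = 0
    · have : C / n ≤ C := div_le_self hC.le hn1
      have h3 : 0 ≤ 3 * C * |(k : ℝ)| ^ (-(4 / 3 : ℝ)) := by positivity
      rw [if_pos hk]; linarith
    · rw [if_neg hk, add_zero]
      have hk0 : 0 < |(k : ℝ)| := abs_pos.2 (by exact_mod_cast hk)
      have hs1 : 1 ≤ √(n : ℝ) := Real.one_le_sqrt.2 hn1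
      have hss : √(n : ℝ) * √n = n := Real.mul_self_sqrt (by positivity)
      have hkA : (k : ℝ) ^ 2 * A ≤ 5 * C * √n := by
        have h1 := hμ.sq_mul_le n hn k
        have h2 := hμ.sq_mul_le n hn (k + 1)
        have h3 := hμ.le n hn (k + 1)
        have h4 : C / √n ≤ C * √n :=
          (div_le_self hC.le hs1).trans (le_mul_of_one_le_right hC.le hs1)
        have h5 : A ≤ (μ n).real {k} + (μ n).real {k + 1} := by
          refine (abs_sub _ _).trans_eq ?_
          rw [abs_of_nonneg measureReal_nonneg, abs_of_nonneg measureReal_nonneg]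
        push_cast at h2
        have h6 : 0 ≤ (μ n).real {k + 1} := measureReal_nonneg
        nlinarith [sq_nonneg (k : ℝ), sq_nonneg ((k : ℝ) + 2)]
      -- interpolate: `A³ = A · A²` makes the powers of `n` cancel
      have hcube : A ^ 3 * |(k : ℝ)| ^ 4 ≤ (3 * C) ^ 3 := by
        have hAn : A * n ≤ C := by rwa [le_div_iff₀ (by positivity)] at hA
        have hk4 : |(k : ℝ)| ^ 4 = ((k : ℝ) ^ 2) ^ 2 := by rw [← sq_abs (k : ℝ)]; ring
        have h1 : ((k : ℝ) ^ 2 * A) ^ 2 ≤ (5 * C * √n) ^ 2 :=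
          pow_le_pow_left₀ (by positivity) hkA 2
        calc A ^ 3 * |(k : ℝ)| ^ 4 = A * ((k : ℝ) ^ 2 * A) ^ 2 := by rw [hk4]; ring
          _ ≤ A * (5 * C * √n) ^ 2 := by gcongr
          _ = 25 * C ^ 2 * (A * n) := by rw [mul_pow, sq (√(n : ℝ)), hss]; ring
          _ ≤ 25 * C ^ 2 * C := by gcongr
          _ ≤ (3 * C) ^ 3 := by nlinarith [pow_pos hC 3]
      refine (pow_le_pow_iff_left₀ hA0 (by positivity) three_ne_zero).1 ?_
      have : (|(k : ℝ)| ^ (-(4 / 3 : ℝ))) ^ 3 = (|(k : ℝ)| ^ 4)⁻¹ := by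
        rw [← Real.rpow_natCast (|(k : ℝ)| ^ (-(4 / 3 : ℝ))), ← Real.rpow_mul hk0.le,
          ← Real.rpow_natCast |(k : ℝ)| 4, ← Real.rpow_neg hk0.le]
        norm_num
      rw [mul_pow, this, ← div_eq_mul_inv, le_div_iff₀ (by positivity)]
      exact hcube

theorem summable_averageTerm_of_bounded [IsProbabilityMeasure μ] {B : ℝ} (hB : ∀ y, ‖f y‖ ≤ B)
    (x : X) : Summable (averageTerm τ μ f x) := by
  refine Summable.of_norm_bounded
    ((hasSum_measureReal_singleton μ).summable.mul_right B) fun k => ?_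
  rw [norm_averageTerm]
  exact mul_le_mul_of_nonneg_left (hB _) measureReal_nonneg

/-- Summation by parts on `ℤ`. -/
theorem norm_tsum_mul_sub_le {w : ℤ → ℝ} (hw : Summable w) (hw0 : ∀ k, 0 ≤ w k) {G : ℤ → 𝕜} {B : ℝ}
    (hG : ∀ k, ‖G k‖ ≤ B) :
    ‖∑' k : ℤ, (w k : 𝕜) * (G k - G (k + 1))‖ ≤ (∑' k : ℤ, |w k - w (k + 1)|) * B := by
  have hw1 : Summable fun k : ℤ => w (k + 1) := (Equiv.addRight (1 : ℤ)).summable_iff.2 hw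
  have hs : ∀ {v : ℤ → ℝ}, Summable v → (∀ j, 0 ≤ v j) → ∀ {H : ℤ → 𝕜}, (∀ k, ‖H k‖ ≤ B) →
      Summable fun k => (v k : 𝕜) * H k := fun {v} hv hv0 {H} hH => by
    refine Summable.of_norm_bounded (hv.mul_right B) fun k => ?_
    rw [norm_mul, RCLike.norm_ofReal, abs_of_nonneg (hv0 k)]
    exact mul_le_mul_of_nonneg_left (hH _) (hv0 k)
  have hs0 := hs hw hw0 hG
  have hs1 := hs hw hw0 fun k => hG (k + 1)
  have hs2 := hs hw1 (fun k => hw0 (k + 1)) fun k => hG (k + 1)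
  have e1 : ∑' k : ℤ, (w k : 𝕜) * G k = ∑' k : ℤ, (w (k + 1) : 𝕜) * G (k + 1) :=
    ((Equiv.addRight (1 : ℤ)).tsum_eq fun k => (w k : 𝕜) * G k).symm
  have e2 : ∑' k : ℤ, (w k : 𝕜) * (G k - G (k + 1)) =
      ∑' k : ℤ, ((w (k + 1) - w k : ℝ) : 𝕜) * G (k + 1) := by
    simp_rw [mul_sub, RCLike.ofReal_sub, sub_mul]
    rw [hs0.tsum_sub hs1, e1, hs2.tsum_sub hs1]
  rw [e2, ← tsum_mul_right]
  refine tsum_of_norm_bounded (((hw.sub hw1).abs.mul_right B).hasSum) fun k => ?_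
  rw [norm_mul, RCLike.norm_ofReal, abs_sub_comm]
  exact mul_le_mul_of_nonneg_left (hG _) (abs_nonneg _)

/-- Weighted averages of bounded coboundaries tend to zero everywhere. -/
theorem tendsto_weightedAverage_sub_comp {μ : ℕ → Measure ℤ} {C : ℝ} (hμ : DiffusiveBounds μ C)
    {B : ℝ} (hB : ∀ y, ‖g y‖ ≤ B) (x : X) :
    Tendsto (fun n => weightedAverage τ (μ n) (g - g ∘ τ) x) atTop (𝓝 0) := by
  refine squeeze_zero_norm (a := fun n => (∑' k : ℤ, |(μ n).real {k} - (μ n).real {k + 1}|) * B)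
    (fun n => ?_) (by simpa using hμ.tendsto_tsum_abs_sub.mul_const B)
  have := hμ.isProb n
  have h := norm_tsum_mul_sub_le (𝕜 := 𝕜) (hasSum_measureReal_singleton (μ n)).summable
    (fun k => measureReal_nonneg) (G := fun k => g ((τ.toEquiv ^ k : Equiv.Perm X) x))
    (fun k => hB _)
  refine le_trans (le_of_eq ?_) h
  refine congrArg norm (tsum_congr fun k => ?_)
  have hk : (τ.toEquiv ^ (k + 1) : Equiv.Perm X) x = τ ((τ.toEquiv ^ k : Equiv.Perm X) x) := by
    rw [add_comm, zpow_add, zpow_one]; rfl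
  rw [hk]
  rfl

theorem ae_hasSum_averageTerm_of_invariant (hτ : MeasurePreserving τ m m) (hg : g ∘ τ =ᵐ[m] g) :
    ∀ᵐ x ∂m, ∀ (μ : Measure ℤ), IsProbabilityMeasure μ →
      HasSum (averageTerm τ μ g x) (g x) := by
  filter_upwards [ae_forall_zpow hτ hg] with x hx μ hμ
  have hconst : ∀ k : ℤ, g ((τ.toEquiv ^ k : Equiv.Perm X) x) = g x := fun k => by
    have hstep : ∀ j : ℤ, g ((τ.toEquiv ^ (j + 1) : Equiv.Perm X) x) =
        g ((τ.toEquiv ^ j : Equiv.Perm X) x) := fun j => by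
      rw [add_comm, zpow_add, zpow_one]; exact hx j
    induction k using Int.induction_on with
    | zero => simp
    | succ i ih => rw [hstep, ih]
    | pred i ih => rw [← ih, ← hstep, sub_add_cancel]
  have h := (RCLike.hasSum_ofReal (𝕜 := 𝕜)).2 (hasSum_measureReal_singleton μ)
  have hterm : averageTerm τ μ g x = fun k => (μ.real {k} : 𝕜) * g x :=
    funext fun k => by rw [averageTerm, hconst]
  rw [hterm]
  simpa using h.mul_right (g x)

end Orbit

/-! ### Moments as integrals -/

theorem absMoment_one_eq (μ : Measure ℤ) :
    absMoment 1 μ = ∫⁻ k : ℤ, ENNReal.ofReal |(k : ℝ)| ∂μ := by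
  simp [absMoment, lintegral_countable']

theorem absMoment_two_eq (μ : Measure ℤ) :
    absMoment 2 μ = ∫⁻ k : ℤ, ENNReal.ofReal ((k : ℝ) ^ 2) ∂μ := by
  simp [absMoment, lintegral_countable']

theorem integrable_abs_of_absMoment_ne_top {μ : Measure ℤ} (h : absMoment 1 μ ≠ ∞) :
    Integrable (fun k : ℤ => |(k : ℝ)|) μ := by
  refine ⟨by fun_prop, ?_⟩
  rw [hasFiniteIntegral_iff_ofReal (ae_of_all _ fun k => abs_nonneg _), ← absMoment_one_eq]
  exact h.lt_top

theorem integrable_sq_of_absMoment_ne_top {μ : Measure ℤ} (h : absMoment 2 μ ≠ ∞) :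
    Integrable (fun k : ℤ => (k : ℝ) ^ 2) μ := by
  refine ⟨by fun_prop, ?_⟩
  rw [hasFiniteIntegral_iff_ofReal (ae_of_all _ fun k => sq_nonneg _), ← absMoment_two_eq]
  exact h.lt_top

theorem integral_abs_eq_absMoment (μ : Measure ℤ) :
    ∫ k : ℤ, |(k : ℝ)| ∂μ = (absMoment 1 μ).toReal := by
  rw [absMoment_one_eq, integral_eq_lintegral_of_nonneg_ae (ae_of_all _ fun k => abs_nonneg _)
    (by fun_prop)]

theorem integral_sq_eq_absMoment (μ : Measure ℤ) :
    ∫ k : ℤ, (k : ℝ) ^ 2 ∂μ = (absMoment 2 μ).toReal := by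
  rw [absMoment_two_eq, integral_eq_lintegral_of_nonneg_ae (ae_of_all _ fun k => sq_nonneg _)
    (by fun_prop)]

theorem integral_eq_expectation {μ : Measure ℤ} (h : Integrable (fun k : ℤ => |(k : ℝ)|) μ) :
    ∫ k : ℤ, (k : ℝ) ∂μ = expectation μ := by
  have hi : Integrable (fun k : ℤ => (k : ℝ)) μ := by
    refine (integrable_norm_iff (by fun_prop)).1 h
  rw [integral_countable hi, expectation]
  exact tsum_congr fun k => by rw [smul_eq_mul, mul_comm]

/-- An eventual linear bound for partial sums of extended nonnegative reals makes all terms finite,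
hence becomes a linear bound for all indices after enlarging the constant. -/
theorem exists_forall_sum_toReal_le {v : ℕ → ℝ≥0∞} {C : ℝ≥0}
    (h : ∀ᶠ n : ℕ in atTop, ∑ i ∈ Finset.range n, v i ≤ (C : ℝ≥0∞) * (n : ℝ≥0∞)) :
    (∀ i, v i ≠ ∞) ∧ ∃ M : ℝ, 0 ≤ M ∧ ∀ n : ℕ, ∑ i ∈ Finset.range n, (v i).toReal ≤ M * n := by
  obtain ⟨N, hN⟩ := eventually_atTop.1 h
  have hfin : ∀ i, v i ≠ ∞ := fun i => by
    have h1 := hN (max N (i + 1)) (le_max_left _ _)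
    have h2 : v i ≤ ∑ j ∈ Finset.range (max N (i + 1)), v j :=
      Finset.single_le_sum (fun j _ => zero_le) (Finset.mem_range.2 (by omega))
    exact ne_top_of_le_ne_top (by finiteness) (h2.trans h1)
  have hreal : ∀ n ≥ N, ∑ i ∈ Finset.range n, (v i).toReal ≤ C * n := fun n hn => by
    rw [← ENNReal.toReal_sum fun i _ => hfin i]
    have := ENNReal.toReal_mono (by finiteness) (hN n hn)
    simpa using this
  have hmono : Monotone fun n => ∑ i ∈ Finset.range n, (v i).toReal :=
    monotone_nat_of_le_succ fun n => by
      rw [Finset.sum_range_succ]; linarith [ENNReal.toReal_nonneg (a := v n)]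
  refine ⟨hfin, C * (N + 1), by positivity, fun n => ?_⟩
  rcases Nat.eq_zero_or_pos n with rfl | hn
  · simp
  have hn1 : (1 : ℝ) ≤ n := by exact_mod_cast hn
  have hC : (0 : ℝ) ≤ C := C.2
  have hN0 : (0 : ℝ) ≤ N := Nat.cast_nonneg N
  rcases le_total N n with hNn | hNn
  · refine (hreal n hNn).trans ?_
    gcongr
    exact le_mul_of_one_le_right hC (by linarith)
  · refine (hmono hNn).trans ((hreal N le_rfl).trans ?_)
    nlinarith [mul_nonneg hC hN0]

/-! ### Convergence almost everywhere -/

section Convergence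

variable {X : Type*} [MeasurableSpace X] {m : Measure X} {τ : X ≃ᵐ X}
  {𝕜 : Type*} [RCLike 𝕜]

theorem coeFn_birkhoffSum_compMeasurePreserving (hτ : MeasurePreserving τ m m) {h : X → 𝕜}
    (hh : MemLp h 2 m) (N : ℕ) :
    (birkhoffSum (Lp.compMeasurePreserving (E := 𝕜) (p := 2) τ hτ) id N (hh.toLp h) : Lp 𝕜 2 m)
      =ᵐ[m] birkhoffSum τ h N := by
  induction N with
  | zero => simpa using Lp.coeFn_zero 𝕜 2 m
  | succ N ih =>
    rw [birkhoffSum_succ]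
    refine (Lp.coeFn_add _ _).trans ?_
    have h1 : ((Lp.compMeasurePreserving (E := 𝕜) (p := 2) τ hτ)^[N] (hh.toLp h) : X → 𝕜) =ᵐ[m]
        h ∘ τ^[N] := by
      rw [Lp.compMeasurePreserving_iterate, Lp.toLp_compMeasurePreserving]
      exact MemLp.coeFn_toLp _
    filter_upwards [ih, h1] with x hx hx1
    rw [birkhoffSum_succ, Pi.add_apply, hx, id, hx1]
    rfl

/-- In `L²` the Birkhoff averages of `h` approach an invariant function. -/
theorem exists_invariant_birkhoffAverage_close [IsProbabilityMeasure m]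
    (hτ : MeasurePreserving τ m m) {h : X → 𝕜} (hh : MemLp h 2 m) {ε : ℝ≥0∞} (hε : 0 < ε) :
    ∃ (N : ℕ) (g : X → 𝕜), 0 < N ∧ MemLp g 2 m ∧ g ∘ τ =ᵐ[m] g ∧
      eLpNorm (birkhoffAverage 𝕜 τ h N - g) 1 m < ε := by
  set U : Lp 𝕜 2 m →ₗᵢ[𝕜] Lp 𝕜 2 m := Lp.compMeasurePreservingₗᵢ 𝕜 τ hτ with hU
  have hlim := U.toContinuousLinearMap.tendsto_birkhoffAverage_orthogonalProjection
    U.norm_toContinuousLinearMap_le (hh.toLp h)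
  set P := (U.toContinuousLinearMap.eqLocus
    (1 : Lp 𝕜 2 m →L[𝕜] Lp 𝕜 2 m)).orthogonalProjectionOnto (hh.toLp h)
  have hP : Lp.compMeasurePreserving τ hτ (P : Lp 𝕜 2 m) = P := P.2
  have hlim' := (Lp.tendsto_Lp_iff_tendsto_eLpNorm' _ _).1 hlim
  obtain ⟨N, hN, hN0⟩ := ((hlim'.eventually (gt_mem_nhds hε)).and (eventually_gt_atTop 0)).exists
  refine ⟨N, (P : Lp 𝕜 2 m), hN0, Lp.memLp _, ?_, ?_⟩
  · refine (Lp.coeFn_compMeasurePreserving (P : Lp 𝕜 2 m) hτ).symm.trans ?_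
    rw [hP]
  · have hA : ((birkhoffAverage 𝕜 U id N (hh.toLp h) : Lp 𝕜 2 m) : X → 𝕜) =ᵐ[m]
        birkhoffAverage 𝕜 τ h N := by
      refine (Lp.coeFn_smul _ _).trans ?_
      filter_upwards [coeFn_birkhoffSum_compMeasurePreserving hτ hh N] with x hx
      exact congrArg (fun z => (N : 𝕜)⁻¹ • z) hx
    have hae : ((birkhoffAverage 𝕜 U id N (hh.toLp h) : Lp 𝕜 2 m) : X → 𝕜) - ⇑(P : Lp 𝕜 2 m) =ᵐ[m]
        birkhoffAverage 𝕜 τ h N - ⇑(P : Lp 𝕜 2 m) := hA.sub EventuallyEq.rfl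
    refine lt_of_le_of_lt ?_ hN
    rw [← eLpNorm_congr_ae hae]
    exact eLpNorm_le_eLpNorm_of_exponent_le (by norm_num)
      ((Lp.aestronglyMeasurable _).sub (Lp.aestronglyMeasurable _))

/-- `h` minus a Birkhoff average of `h` is a coboundary. -/
theorem exists_sub_comp_eq_sub_birkhoffAverage {h : X → 𝕜} {B : ℝ} (hB : ∀ x, ‖h x‖ ≤ B) {N : ℕ}
    (hN : 0 < N) :
    ∃ (g : X → 𝕜) (B' : ℝ), (∀ x, ‖g x‖ ≤ B') ∧ g - g ∘ τ = h - birkhoffAverage 𝕜 τ h N := by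
  refine ⟨fun x => (N : 𝕜)⁻¹ * ∑ j ∈ Finset.range N, birkhoffSum τ h j x,
    ‖(N : 𝕜)⁻¹‖ * ∑ j ∈ Finset.range N, ∑ i ∈ Finset.range j, B, fun x => ?_, ?_⟩
  · rw [norm_mul]
    refine mul_le_mul_of_nonneg_left ?_ (norm_nonneg _)
    exact norm_sum_le_of_le _ fun j _ => norm_sum_le_of_le _ fun i _ => hB _
  · funext x
    have hN0 : (N : 𝕜) ≠ 0 := by exact_mod_cast hN.ne'
    have hj : ∀ j, birkhoffSum τ h j x - birkhoffSum τ h j (τ x) = h x - h (τ^[j] x) := fun j => by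
      rw [← neg_sub, birkhoffSum_apply_sub_birkhoffSum, neg_sub]
    simp only [Pi.sub_apply, Function.comp, ← mul_sub, ← Finset.sum_sub_distrib, hj]
    rw [Finset.sum_sub_distrib, Finset.sum_const, Finset.card_range, nsmul_eq_mul, mul_sub,
      inv_mul_cancel_left₀ hN0]
    rfl

/-- Up to an arbitrarily small error in `L¹`, every integrable function is the sum of a bounded
coboundary and an invariant function, so its weighted averages converge almost everywhere. -/
theorem exists_ae_tendsto_weightedAverage_close [IsProbabilityMeasure m]
    (hτ : MeasurePreserving τ m m) {μ : ℕ → Measure ℤ} {C : ℝ} (hμ : DiffusiveBounds μ C)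
    {f : X → 𝕜} (hf : Integrable f m) {ε : ℝ} (hε : 0 < ε) :
    ∃ c e : X → 𝕜, f = c + e ∧ Integrable e m ∧ ∫ x, ‖e x‖ ∂m ≤ ε ∧
      ∀ᵐ x ∂m, (∀ n, Summable (averageTerm τ (μ n) c x)) ∧
        ∃ L, Tendsto (fun n => weightedAverage τ (μ n) c x) atTop (𝓝 L) := by
  have hε2 : 0 < ENNReal.ofReal (ε / 2) := ENNReal.ofReal_pos.2 (by positivity)
  obtain ⟨h, hfh, -⟩ := (memLp_one_iff_integrable.2 hf).exists_simpleFunc_eLpNorm_sub_lt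
    ENNReal.one_ne_top hε2.ne'
  obtain ⟨B, hB⟩ := h.exists_forall_norm_le
  have hh : MemLp h 2 m := MemLp.of_bound h.aestronglyMeasurable B (ae_of_all _ hB)
  obtain ⟨N, p, hN, hp, hpinv, hclose⟩ := exists_invariant_birkhoffAverage_close hτ hh hε2
  obtain ⟨g, B', hgB, hg⟩ := exists_sub_comp_eq_sub_birkhoffAverage (τ := τ) hB hN
  have hAm : AEStronglyMeasurable (birkhoffAverage 𝕜 τ h N) m := by
    have : Measurable (birkhoffAverage 𝕜 τ h N) :=
      (Finset.measurable_fun_sum _ fun i _ =>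
        h.measurable.comp (τ.measurable.iterate i)).const_smul (N : 𝕜)⁻¹
    exact this.aestronglyMeasurable
  set e : X → 𝕜 := (f - ⇑h) + (birkhoffAverage 𝕜 τ h N - p) with he
  have hem1 : AEStronglyMeasurable (f - ⇑h) m := hf.1.sub h.aestronglyMeasurable
  have hem2 : AEStronglyMeasurable (birkhoffAverage 𝕜 τ h N - p) m := hAm.sub hp.1
  have heε : eLpNorm e 1 m ≤ ENNReal.ofReal ε := by
    refine (eLpNorm_add_le hem1 hem2 le_rfl).trans ((add_le_add hfh.le hclose.le).trans ?_)
    rw [← ENNReal.ofReal_add (by positivity) (by positivity), add_halves]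
  have hei : Integrable e m :=
    memLp_one_iff_integrable.1 ⟨hem1.add hem2, heε.trans_lt ENNReal.ofReal_lt_top⟩
  refine ⟨(g - g ∘ τ) + p, e, ?_, hei, ?_, ?_⟩
  · rw [hg, he]; abel
  · rw [integral_norm_eq_lintegral_enorm hei.1, ← eLpNorm_one_eq_lintegral_enorm]
    exact ENNReal.toReal_le_of_le_ofReal hε.le heε
  · filter_upwards [ae_hasSum_averageTerm_of_invariant hτ hpinv] with x hx
    have hsc : ∀ n, Summable (averageTerm τ (μ n) (g - g ∘ τ) x) := fun n => by
      have := hμ.isProb n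
      exact summable_averageTerm_of_bounded (B := B' + B')
        (fun y => (norm_sub_le _ _).trans (add_le_add (hgB _) (hgB _))) x
    have hsp := fun n => hx (μ n) (hμ.isProb n)
    refine ⟨fun n => ?_, p x, ?_⟩
    · exact ((hsc n).add (hsp n).summable).congr fun k => (averageTerm_add k).symm
    · have := (tendsto_weightedAverage_sub_comp (τ := τ) hμ hgB x).add_const (p x)
      rw [zero_add] at this
      refine this.congr fun n => ?_
      rw [weightedAverage_add (hsc n) (hsp n).summable]
      congr 1
      exact (hsp n).tsum_eq.symm

/-- Banach's principle: the weak type inequality upgrades convergence on a dense class to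
convergence for every integrable function. -/
theorem ae_tendsto_weightedAverage [IsProbabilityMeasure m]
    (hτ : MeasurePreserving τ m m) {μ : ℕ → Measure ℤ} {C : ℝ} (hμ : DiffusiveBounds μ C)
    {f : X → 𝕜} (hf : Integrable f m) :
    ∀ᵐ x ∂m, ∃ L, Tendsto (fun n => weightedAverage τ (μ n) f x) atTop (𝓝 L) := by
  have hC := hμ.pos
  have hosc : ∀ δ : ℝ, 0 < δ → ∀ᵐ x ∂m, ∃ N : ℕ, ∀ n ≥ N,
      dist (weightedAverage τ (μ n) f x) (weightedAverage τ (μ N) f x) < δ := by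
    intro δ hδ
    set l := δ / (64 * C) with hl
    have hl0 : 0 < l := by positivity
    have hle : ∀ ε : ℝ, 0 < ε → m {x | ¬ ∃ N : ℕ, ∀ n ≥ N,
        dist (weightedAverage τ (μ n) f x) (weightedAverage τ (μ N) f x) < δ} ≤
        2 * ENNReal.ofReal (ε / l) := by
      intro ε hε
      obtain ⟨c, e, hfce, hei, heε, hc⟩ := exists_ae_tendsto_weightedAverage_close hτ hμ hf hε
      have hes : ∀ᵐ x ∂m, ∀ n, Summable (averageTerm τ (μ n) e x) := ae_all_iff.2 fun n => by
        have := hμ.isProb n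
        exact ae_summable_averageTerm hτ hei (μ n)
      refine (measure_mono_ae (t := {x | ∃ n : ℕ, 0 < n ∧
        16 * C * l < ‖weightedAverage τ (μ n) e x‖}) ?_).trans
        ((measure_exists_lt_norm_weightedAverage_le hτ hμ hei hl0).trans ?_)
      · filter_upwards [hc, hes] with x ⟨hcs, L, hL⟩ hxe
        intro hx
        by_contra hsmall
        have hsmall' : ∀ n : ℕ, 0 < n → ‖weightedAverage τ (μ n) e x‖ ≤ δ / 4 := fun n hn => by
          by_contra! hlt
          refine hsmall ⟨n, hn, lt_of_eq_of_lt ?_ hlt⟩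
          rw [hl]; field_simp; norm_num
        refine hx ?_
        obtain ⟨N, hN⟩ := Metric.cauchySeq_iff'.1 hL.cauchySeq (δ / 4) (by positivity)
        refine ⟨N + 1, fun n hn => ?_⟩
        have h1 := hN n (by omega)
        have h2 := hN (N + 1) (by omega)
        have h3 := hsmall' n (by omega)
        have h4 := hsmall' (N + 1) (by omega)
        rw [hfce, weightedAverage_add (hcs n) (hxe n),
          weightedAverage_add (hcs (N + 1)) (hxe (N + 1))]
        refine (dist_add_add_le _ _ _ _).trans_lt ?_
        have h5 := dist_triangle_right (weightedAverage τ (μ n) c x)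
          (weightedAverage τ (μ (N + 1)) c x) (weightedAverage τ (μ N) c x)
        have h6 := dist_le_norm_add_norm (weightedAverage τ (μ n) e x)
          (weightedAverage τ (μ (N + 1)) e x)
        linarith
      · gcongr
    have hlim : Tendsto (fun ε : ℝ => 2 * ENNReal.ofReal (ε / l)) (𝓝[>] 0) (𝓝 0) := by
      have h1 : Tendsto (fun ε : ℝ => ε / l) (𝓝[>] 0) (𝓝 0) := by
        have := (continuous_id.div_const l).tendsto (0 : ℝ)
        simp only [id, zero_div] at this
        exact this.mono_left nhdsWithin_le_nhds
      have h2 := ENNReal.tendsto_ofReal h1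
      rw [ENNReal.ofReal_zero] at h2
      simpa using ENNReal.Tendsto.const_mul (a := 2) h2 (Or.inr ENNReal.ofNat_ne_top)
    exact le_antisymm (ge_of_tendsto hlim
      (eventually_nhdsWithin_of_forall fun ε hε => hle ε hε)) (zero_le)
  have hall : ∀ᵐ x ∂m, ∀ j : ℕ, ∃ N : ℕ, ∀ n ≥ N,
      dist (weightedAverage τ (μ n) f x) (weightedAverage τ (μ N) f x) < 1 / ((j : ℝ) + 1) :=
    ae_all_iff.2 fun j => hosc _ Nat.one_div_pos_of_nat
  filter_upwards [hall] with x hx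
  refine cauchySeq_tendsto_of_complete (Metric.cauchySeq_iff'.2 fun δ hδ => ?_)
  obtain ⟨j, hj⟩ := exists_nat_one_div_lt hδ
  obtain ⟨N, hN⟩ := hx j
  exact ⟨N, fun n hn => (hN n hn).trans hj⟩

end Convergence

theorem theorem3p4 {X : Type*} [MeasurableSpace X] (m : Measure X) [IsProbabilityMeasure m]
    (τ : X ≃ᵐ X) (hτ : MeasurePreserving τ m m)
    (ν : ℕ → Measure ℤ) (hν : ∀ n, IsProbabilityMeasure (ν n))
    (a : ℝ≥0) (ρ : ℝ) (hρ : ρ < 1)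
    (hE : ∀ n, expectation (ν n) = 0)
    (hm₁ : ∀ n, absMoment 1 (ν n) ≤ a)
    (hcoset : ∀ (n : ℕ) (β α : ℤ), 2 ≤ β → (ν n).real {k : ℤ | ∃ j : ℤ, k = β * j + α} ≤ ρ)
    (hm₂ : ∃ C : ℝ≥0, ∀ᶠ n : ℕ in atTop,
      ∑ i ∈ Finset.range n, absMoment 2 (ν i) ≤ (C : ℝ≥0∞) * (n : ℝ≥0∞))
    {𝕜 : Type*} [RCLike 𝕜] (f : X → 𝕜) (hf : Integrable f m) :
    ∀ᵐ x ∂m, (∀ n : ℕ, Summable (averageTerm τ (convProd ν n) f x)) ∧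
      ∃ L : 𝕜, Tendsto (fun n : ℕ => weightedAverage τ (convProd ν n) f x) atTop (𝓝 L) := by
  obtain ⟨C, hC⟩ := hm₂
  obtain ⟨hfin, M, hM, hV⟩ := exists_forall_sum_toReal_le hC
  have h1 : ∀ n, Integrable (fun k : ℤ => |(k : ℝ)|) (ν n) := fun n =>
    integrable_abs_of_absMoment_ne_top (ne_top_of_le_ne_top ENNReal.coe_ne_top (hm₁ n))
  obtain ⟨c, hc, hchar⟩ := exists_norm_fourierMoment_zero_le a hρ
  obtain ⟨C', hμ⟩ := exists_diffusiveBounds_convProd hν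
    (fun n => integrable_sq_of_absMoment_ne_top (hfin n))
    (fun n => (integral_eq_expectation (h1 n)).trans (hE n)) hc
    (fun n => hchar (ν n) (hν n) (h1 n)
      ((integral_abs_eq_absMoment _).trans_le (ENNReal.toReal_le_coe_of_le_coe (hm₁ n)))
      (hcoset n)) hM (by simpa only [integral_sq_eq_absMoment] using hV)
  filter_upwards [ae_tendsto_weightedAverage hτ hμ hf, ae_all_iff.2 fun n =>
    have := hμ.isProb n
    ae_summable_averageTerm hτ hf (convProd ν n)] with x hx hxs using ⟨hxs, hx⟩
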